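/- **Setting.** Let $k$ be a commutative ring and $\mathcal O=\mathcal P(E,R)$ a graded quadratic operad over $k$, with generating graded $\mathbb S$-module $E$, $E(0)=0$, and relations $R\subseteq E\circ_{(1)}E$. Let $\mathcal O^{¡}=\mathcal C(sE,s^2R)$ be its Koszul dual cooperad: the largest subcooperad of the cofree conilpotent cooperad on $sE$ whose weight $2$ projection lies in $s^2R\subseteq s^2(E\circ_{(1)}E)\cong sE\circ_{(1)}sE$, where $s^2(\mu_1\circ_l\mu_2)$ corresponds to $(-1)^{|\mu_1|}s\mu_1\circ_l s\mu_2$. Write $$\Delta_{(1)}(\mu)=\sum_{(\mu)}(\mu^{(1)}\circ_l\mu^{(2)})\cdot\sigma,\qquad \Delta(\mu)=\sum(\nu;\nu_1,\dots,\nu_m)\cdot\sigma$$ for its infinitesimal decomposition and its decomposition, and put $\alpha_\sigma=\sum_{s<t,\ \sigma(s)>\sigma(t)}|x_s||x_t|$ (when $\mathcal O^{¡}\circ\mathcal O^{¡}$ does not embed into trees, the formulas below are required for every such expression of $\Delta_{(1)}(\mu)$ and $\Delta(\mu)$ in terms of trees; under the usual hypotheses, $\mathcal O$ Koszul and $k$-projective,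 and $\mathbb Q\subseteq k$ or $\mathcal O$ non-symmetric, it does embed). All signs $|x|$ below refer to the total degree. *A derived homotopy $\mathcal O$-algebra* is a bigraded $k$-module $M=\bigoplus_{p\ge 0,\,q\in\mathbb Z}M_{p,q}$, with total degree $p+q$ and filtration $F_mM_n=\bigoplus_{p\le m}M_{p,n-p}$, a differential $d$ with $d(F_mM_n)\subseteq F_mM_{n-1}$, $d^2=0$, and operations $\mu(x_1,\dots,x_r)$, $\mu\in\mathcal O^{¡}(r)$, which are $k$-multilinear and equivariant, send $F_{m_1}M_{n_1}\otimes\cdots\otimes F_{m_r}M_{n_r}$ to $F_{\sum m_i}M_{|\mu|-1+\sum n_i}$, and satisfy $1(x)=0$ and $$d\mu(x_1,\dots,x_r)-\sum_{i}(-1)^{|\mu|-1+\sum_{j<i}|x_j|}\mu(\dots,dx_i,\dots)+\sum_{(\mu)}(-1)^{\eta_1}\mu^{(1)}(x_{\sigma^{-1}(1)},\dots,\mu^{(2)}(x_{\sigma^{-1}(l)},\dots),\dots)=0,$$ with $\eta_1=\alpha_\sigma+|\mu^{(1)}|+(|\mu^{(2)}|+1)\sum_{m<l}|x_{\sigma^{-1}(m)}|$.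 For $i\ge 0$, $d_i\colon M_{p,q}\to M_{p-i,q-1+i}$ denotes the piece of $d$ that lowers the horizontal degree by $i$, and $\mu_i$ denotes the piece of the operation $\mu$ that lowers the total horizontal degree by $i$. A differential graded $\mathcal O$-algebra $A$ is regarded as a derived homotopy $\mathcal O$-algebra concentrated in horizontal degree $0$, in which $s\mu$ acts as $\mu$ for $\mu\in E$ and elements of weight $\neq1$ act trivially. *A derived $\infty$-morphism* $f\colon M\leadsto N$ consists of $k$-multilinear equivariant maps $f(\mu)$, $\mu\in\mathcal O^{¡}(r)$, that send $F_{m_1}M_{n_1}\otimes\cdots\otimes F_{m_r}M_{n_r}$ to $F_{\sum m_i}N_{|\mu|+\sum n_i}$ and satisfy $$\begin{aligned}d f(\mu)(x_1,\dots,x_r)-\sum_i(-1)^{|\mu|+\sum_{j<i}|x_j|}f(\mu)(\dots,dx_i,\dots)&=\sum_{(\mu)}(-1)^{\eta_1}f(\mu^{(1)})(x_{\sigma^{-1}(1)},\dots,\mu^{(2)}(x_{\sigma^{-1}(l)},\dots),\dots)\\&\quad-\sum(-1)^{\epsilon}\nu(f(\nu_1)(x_{\sigma^{-1}(1)},\dots),\dots,f(\nu_m)(\dots,x_{\sigma^{-1}(r)})),\end{aligned}$$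 where $\epsilon$ is $\alpha_\sigma$ plus the sum over $j$ of $|\nu_j|$ times the total degree of the inputs of $\nu_1,\dots,\nu_{j-1}$. Again $f(\mu)_i$ is the piece lowering the horizontal degree by $i$. *A (derived) minimal model* of a differential graded $\mathcal O$-algebra $A$ is a derived $\infty$-morphism $f\colon M\leadsto A$ such that $d_0=0$ in $M$, each $M_{p,q}$ is $k$-projective, and $f(1)$ induces an isomorphism between the $E^2$ pages of the spectral sequences of the filtered complexes $M$ and $A$. Then $f(1)_0$ takes values in the cycles of $A$; let $\rho\colon M\to Z_*(A)\twoheadrightarrow H_*(A)$ be the composite of $f(1)_0$ and the projection to homology. *Torsion Massey products.* Let $A$ be a differential graded $\mathcal O$-algebra, $\mu\in E(r)$ homogeneous of degree $|\mu|$, $t_1,\dots,t_r\in k$ with $\sum_i t_i=0$, and $x_i\in H_{|x_i|}(A)$ with $t_ix_i=0$. Put $\beta_i=|\mu|+\sum_{j<i}|x_j|$. The torsion Massey product $\langle\mu;t_1,\dots,t_r\rangle(x_1,\dots,x_r)\subseteq H_{|\mu|+\sum_i|x_i|+1}(A)$ is the coset of $$\sum_{i=1}^r\mu(x_1,\dots,x_{i-1},H_{|x_i|+1}(A),x_{i+1},\dots,x_r)$$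 represented by the class of $\sum_i(-1)^{\beta_i}\mu(y_1,\dots,y_{i-1},z_i,y_{i+1},\dots,y_r)$, where $y_i\in A_{|x_i|}$ is a cycle representing $x_i$ and $z_i\in A_{|x_i|+1}$ satisfies $d(z_i)=t_iy_i$. **Theorem.** Let $f\colon M\leadsto A$ be a minimal model of a differential graded $\mathcal O$-algebra $A$, and let $\mu,t_i,x_i$ be as above. Then: 1. there are $u_i\in M_{0,|x_i|}$ such that $f(1)_0(u_i)$ represents $x_i$, $1\le i\le r$; 2. for every such choice of the $u_i$ there are $v_i\in M_{1,|x_i|}$ with $d_1(v_i)=t_iu_i$, $1\le i\le r$; 3. for every such choice of the $u_i$ and $v_i$ there is $w\in M_{2,|\mu|+\sum_i|x_i|}$ with $$d_1(w)=\sum_{i=1}^r(-1)^{\beta_i}(s\mu)_0(u_1,\dots,u_{i-1},v_i,u_{i+1},\dots,u_r);$$ 4. for every such choice of the $u_i$, the $v_i$ and $w$, the element $$\sum_{i=1}^r(-1)^{\beta_i}\rho\big((s\mu)_1(u_1,\dots,u_{i-1},v_i,u_{i+1},\dots,u_r)\big)-\rho(d_2(w))$$ lies in $H_{|\mu|+\sum_i|x_i|+1}(A)$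 and belongs to the torsion Massey product $\langle\mu;t_1,\dots,t_r\rangle(x_1,\dots,x_r)$. -/

import Mathlib

open Finsupp

universe u v w

/-! ### Signs -/

/-- The scalar `(-1)^n`. -/
def koszulSgn (k : Type*) [CommRing k] (n : ℤ) : k := ((n.negOnePow : ℤˣ) : ℤ)

/-- Exponent of the Koszul sign of a word of homogeneous symbols `(key, degree)`: the sum of the
products of the degrees over all pairs of positions `i < j` whose keys are out of order. It is the
sign of the permutation that brings the word from the order given by the keys into the given one. -/
def koszulExp {κ : Type*} [LT κ] [DecidableRel (α := κ) (· < ·)] : List (κ × ℤ) → ℤ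
  | [] => 0
  | a :: l => (l.map fun b => if b.1 < a.1 then a.2 * b.2 else 0).sum + koszulExp l

/-- `α_σ = ∑_{s < t, σ s > σ t} |x_s| |x_t|`, where `deg s = |x_s|`. -/
def permExp {r : ℕ} (σ : Equiv.Perm (Fin r)) (deg : Fin r → ℤ) : ℤ :=
  koszulExp (List.ofFn fun i => (σ.symm i, deg (σ.symm i)))

/-- Sum of `deg j` over `j < i`. -/
def sumBefore {r : ℕ} (deg : Fin r → ℤ) (i : Fin r) : ℤ :=
  ∑ j ∈ Finset.univ.filter (fun j => j < i), deg j

/-! ### Graded symmetric sequences and trees -/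

/-- A graded `𝕊`-module over `k`: `obj r n` is the arity `r`, degree `n` part, with a `k`-linear
right action of the symmetric group. -/
structure GradedSModule (k : Type u) [CommRing k] where
  obj : ℕ → ℤ → Type v
  [addCommGroup : ∀ r n, AddCommGroup (obj r n)]
  [module : ∀ r n, Module k (obj r n)]
  act : ∀ {r : ℕ} {n : ℤ}, Equiv.Perm (Fin r) → obj r n →ₗ[k] obj r n
  act_one : ∀ {r : ℕ} {n : ℤ} (e : obj r n), act 1 e = e
  act_mul : ∀ {r : ℕ} {n : ℤ} (σ τ : Equiv.Perm (Fin r)) (e : obj r n),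
    act (σ * τ) e = act τ (act σ e)

attribute [instance] GradedSModule.addCommGroup GradedSModule.module

/-- Planar trees with vertices decorated by elements of `E` of the matching arity and by a colour
in `C`, and with leaves labelled by `L`. -/
inductive OpTree (E : ℕ → ℤ → Type v) (C : Type) (L : Type) : Type v
  | leaf (l : L) : OpTree E C L
  | node (c : C) (r : ℕ) (n : ℤ) (e : E r n) (ch : Fin r → OpTree E C L) : OpTree E C L

namespace OpTree

variable {E : ℕ → ℤ → Type v} {C C' L L' : Type}

/-- Degree of a tree, when each vertex decorated by `E r n` is given the degree `n + s`
(`s = 0` for trees on `E`, `s = 1` for trees on the suspension `sE`). -/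
def deg (s : ℤ) : OpTree E C L → ℤ
  | leaf _ => 0
  | node _ _ n _ ch => n + s + ∑ i, (ch i).deg s

/-- Number of vertices. -/
def weight : OpTree E C L → ℕ
  | leaf _ => 0
  | node _ _ _ _ ch => 1 + ∑ i, (ch i).weight

/-- The list of leaf labels, from left to right. -/
def leaves : OpTree E C L → List L
  | leaf l => [l]
  | node _ _ _ _ ch => (List.ofFn fun i => (ch i).leaves).flatten

/-- Each label occurs exactly once. -/
def IsMultilinear {r : ℕ} (t : OpTree E C (Fin r)) : Prop := t.leaves.Perm (List.finRange r)

/-- Change colours and labels. -/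
def map (g : C → C') (h : L → L') : OpTree E C L → OpTree E C' L'
  | leaf l => leaf (h l)
  | node c r n e ch => node (g c) r n e fun i => (ch i).map g h

/-- Graft trees onto the leaves. -/
def bind (f : L → OpTree E C L') : OpTree E C L → OpTree E C L'
  | leaf l => f l
  | node c r n e ch => node c r n e fun i => (ch i).bind f

/-- The word of the tree in planar (depth first) order: vertices have key `⊥` and degree `n + s`,
and a leaf with label `l` has key `l` and degree `d l`. -/
def word (s : ℤ) (d : L → ℤ) : OpTree E C L → List (WithBot L × ℤ)
  | leaf l => [((l : WithBot L), d l)]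
  | node _ _ n _ ch => (⊥, n + s) :: (List.ofFn fun i => (ch i).word s d).flatten

/-- Degree of the decoration of the root vertex. -/
def rootDeg : OpTree E C L → ℤ
  | leaf _ => 0
  | node _ _ n _ _ => n

/-- The tree with one vertex decorated by `e` and leaves `0, 1, ..., r - 1`. -/
def corolla {r : ℕ} {n : ℤ} (e : E r n) : OpTree E Unit (Fin r) := node () r n e leaf

/-- Give all vertices and all leaves the colour `b`, after relabelling by `h`. -/
def paint (b : Bool) (h : L → L') (t : OpTree E Unit L) : OpTree E Bool (Bool × L') :=
  t.map (fun _ => b) fun l => (b, h l)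

end OpTree

/-- Multilinear extension to formal linear combinations of a map defined on families. -/
noncomputable def multiExt (k : Type u) [CommRing k] {m : ℕ} {X : Type*} {V : Type*}
    [AddCommGroup V] [Module k V] (g : (Fin m → X) → V) (z : Fin m → X →₀ k) : V :=
  ∑ x ∈ Fintype.piFinset fun i => (z i).support, (∏ i, z i (x i)) • g x

section TreeModule

variable {k : Type u} [CommRing k] (E : GradedSModule.{u, v} k)

/-- The relations between trees: linearity in the decoration of each vertex, and equivariance
`(e · σ)(t₁, ..., t_r) = ± e(t_{σ⁻¹(1)}, ..., t_{σ⁻¹(r)})` at each vertex. -/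
inductive TreeRel (s : ℤ) (C L : Type) : (OpTree E.obj C L →₀ k) → Prop
  | add (c : C) (r : ℕ) (n : ℤ) (e e' : E.obj r n) (ch : Fin r → OpTree E.obj C L) :
      TreeRel s C L (single (.node c r n (e + e') ch) 1 - single (.node c r n e ch) 1
        - single (.node c r n e' ch) 1)
  | smul (c : C) (r : ℕ) (n : ℤ) (a : k) (e : E.obj r n) (ch : Fin r → OpTree E.obj C L) :
      TreeRel s C L (single (.node c r n (a • e) ch) 1 - single (.node c r n e ch) a)
  | perm (c : C) (r : ℕ) (n : ℤ) (σ : Equiv.Perm (Fin r)) (e : E.obj r n)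
      (ch : Fin r → OpTree E.obj C L) :
      TreeRel s C L (single (.node c r n (E.act σ e) ch) 1
        - single (.node c r n e fun i => ch (σ.symm i))
            (koszulSgn k (permExp σ fun i => (ch i).deg s)))
  | congr (c : C) (r : ℕ) (n : ℤ) (e : E.obj r n) (ch : Fin r → OpTree E.obj C L) (i : Fin r)
      (z : OpTree E.obj C L →₀ k) (hz : TreeRel s C L z) :
      TreeRel s C L (z.mapDomain fun t => .node c r n e (Function.update ch i t))

/-- The submodule spanned by the relations between trees. -/
noncomputable def treeRel (s : ℤ) (C L : Type) : Submodule k (OpTree E.obj C L →₀ k) :=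
  Submodule.span k {z | TreeRel E s C L z}

/-- The tree module on `s^s E`, with vertices coloured by `C` and leaves labelled by `L`. For
`C = Unit` and `L = Fin r`, its multilinear part is the arity `r` part of the free operad (and of
the cofree conilpotent cooperad) on the `s`-fold suspension of `E`. For `C = Bool` one gets the same
for the sum of two copies of `E`. -/
abbrev TreeModule (s : ℤ) (C L : Type) : Type (max u v) :=
  (OpTree E.obj C L →₀ k) ⧸ treeRel E s C L

/-- The class of a formal linear combination of trees. -/
noncomputable abbrev treeMk (s : ℤ) (C L : Type) : (OpTree E.obj C L →₀ k) →ₗ[k] TreeModule E s C L :=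
  (treeRel E s C L).mkQ

/-- Formal linear combinations of trees with leaves labelled bijectively by `Fin r`, and total
degree `n`. -/
noncomputable def multilinearTrees (s : ℤ) (r : ℕ) (n : ℤ) : Submodule k (OpTree E.obj Unit (Fin r) →₀ k) :=
  Finsupp.supported k k {t | t.IsMultilinear ∧ t.deg s = n}

/-- Relabelling which realizes the right action of `σ`. -/
noncomputable def relabel {r : ℕ} (σ : Equiv.Perm (Fin r)) :
    (OpTree E.obj Unit (Fin r) →₀ k) →ₗ[k] (OpTree E.obj Unit (Fin r) →₀ k) :=
  Finsupp.lmapDomain k k (OpTree.map id σ.symm)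

/-- Formal linear combinations of trees with exactly two vertices. -/
noncomputable def weightTwoTrees (r : ℕ) : Submodule k (OpTree E.obj Unit (Fin r) →₀ k) :=
  Finsupp.supported k k {t | t.weight = 2}

end TreeModule

/-- Quadratic data: a generating graded `𝕊`-module `E` with `E(0) = 0` and a graded sub-`𝕊`-module
`R ⊆ E ∘₍₁₎ E` of relations, where `E ∘₍₁₎ E` is the weight two part of the free operad on `E`. -/
structure QuadraticData (k : Type u) [CommRing k] where
  E : GradedSModule.{u, v} k
  reduced : ∀ n, Subsingleton (E.obj 0 n)
  R : ∀ (r : ℕ) (_ : ℤ), Submodule k (TreeModule E 0 Unit (Fin r))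
  R_le : ∀ r n, R r n ≤ (multilinearTrees E 0 r n ⊓ weightTwoTrees E r).map (treeMk E 0 _ _)
  R_act : ∀ r n (σ : Equiv.Perm (Fin r)) (z : OpTree E.obj Unit (Fin r) →₀ k),
    treeMk E 0 _ _ z ∈ R r n → treeMk E 0 _ _ (relabel E σ z) ∈ R r n

section Decomposition

variable {k : Type u} [CommRing k] (E : GradedSModule.{u, v} k)

/-- The decomposition `Δ` of the cofree cooperad on a tree. A two-levelled tree is encoded by
colouring its lower part `false` and its upper part (including all leaves) `true`; the sum is over
all the ways to cut the tree in two levels. -/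
noncomputable def cut {L : Type} : OpTree E.obj Unit L → (OpTree E.obj Bool (Bool × L) →₀ k)
  | .leaf l => single (.leaf (true, l)) 1
  | .node c r n e ch => single ((OpTree.node c r n e ch).paint true id) 1
      + multiExt k (fun t => single (.node false r n e t) 1) fun i => cut (ch i)

/-- The infinitesimal decomposition `Δ₍₁₎` of the cofree cooperad on a tree: the sum over all
edges (the root and the leaves included), with the part of the tree above the edge (including its
leaves) coloured `true` and the rest (including its leaves) coloured `false`. -/
noncomputable def infCut {L : Type} : OpTree E.obj Unit L → (OpTree E.obj Bool (Bool × L) →₀ k)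
  | .leaf l => single (.leaf (true, l)) 1
  | .node c r n e ch => single ((OpTree.node c r n e ch).paint true id) 1
      + ∑ i, (infCut (ch i)).mapDomain fun t =>
          .node false r n e (Function.update (fun j => (ch j).paint false id) i t)

/-- The composite `(ν; ν₁, ..., ν_m)` in trees on two copies of `sE`, where `ν` is coloured `false`:
graft `ν_j` onto the leaf `j` of `ν`, with the Koszul sign that brings the vertices of
`ν, ν₁, ..., ν_m` into planar order. -/
noncomputable def graft {m : ℕ} {L : Type} (ν : OpTree E.obj Unit (Fin m) →₀ k)
    (νs : Fin m → OpTree E.obj Bool (Bool × L) →₀ k) : OpTree E.obj Bool (Bool × L) →₀ k :=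
  ν.sum fun t a => a • multiExt k
    (fun x : Fin m → OpTree E.obj Bool (Bool × L) =>
      single ((t.map (fun _ => false) id).bind x)
        (koszulSgn k (koszulExp (t.word 1 fun j => (x j).deg 1)))) νs

variable {E} (K : ∀ (r : ℕ) (_ : ℤ), Submodule k (TreeModule E 1 Unit (Fin r)))

/-- Representatives of elements of arity `r` and degree `n` of a graded subcollection `K` of the
tree module on `sE`. -/
structure KRep (r : ℕ) (n : ℤ) where
  z : OpTree E.obj Unit (Fin r) →₀ k
  homogeneous : z ∈ multilinearTrees E 1 r n
  mem : treeMk E 1 _ _ z ∈ K r n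

/-- The element represented. -/
noncomputable def KRep.elt {K : ∀ (r : ℕ) (_ : ℤ), Submodule k (TreeModule E 1 Unit (Fin r))} {r : ℕ} {n : ℤ}
    (a : KRep K r n) : K r n := ⟨treeMk E 1 _ _ a.z, a.mem⟩

/-- An elementary element `(ν; ν₁, ..., ν_m) · σ` of `(K ∘ K)(r)`. The input `p` of `ν_j` carries the
label `lab j p`, i.e. if it is the input number `i` of the composite then `lab j p = σ⁻¹(i)`. -/
structure CompTerm (r : ℕ) where
  m : ℕ
  n : ℤ
  ν : KRep K m n
  ar : Fin m → ℕ
  ns : Fin m → ℤ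
  νs : ∀ j, KRep K (ar j) (ns j)
  lab : ∀ j, Fin (ar j) → Fin r
  lab_bij : Function.Bijective fun p : Σ j, Fin (ar j) => lab p.1 p.2

/-- An elementary element `(a ∘_l b) · σ` of `(K ∘₍₁₎ K)(r)`. The input `j ≠ l` of `a` carries the
label `labA j` and the input `p` of `b` carries the label `labB p`. If one of them is the input
number `i` of the composite then its label is `σ⁻¹(i)`. -/
structure InfTerm (r : ℕ) where
  rA : ℕ
  nA : ℤ
  a : KRep K rA nA
  rB : ℕ
  nB : ℤ
  b : KRep K rB nB
  l : Fin rA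
  labA : {j // j ≠ l} → Fin r
  labB : Fin rB → Fin r
  lab_bij : Function.Bijective (Sum.elim labA labB)

variable {K}

/-- The element of the module of two-levelled trees given by `(ν; ν₁, ..., ν_m) · σ`. -/
noncomputable def CompTerm.toTrees {r : ℕ} (T : CompTerm K r) :
    TreeModule E 1 Bool (Bool × Fin r) :=
  treeMk E 1 _ _ (graft E T.ν.z fun j => (T.νs j).z.mapDomain (OpTree.paint true (T.lab j)))

/-- The element of the module of two-levelled trees given by `(a ∘_l b) · σ`. -/
noncomputable def InfTerm.toTrees {r : ℕ} (T : InfTerm K r) :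
    TreeModule E 1 Bool (Bool × Fin r) :=
  treeMk E 1 _ _ (graft E T.a.z fun j =>
    if h : j = T.l then T.b.z.mapDomain (OpTree.paint true T.labB)
    else single (.leaf (false, T.labA ⟨j, h⟩)) 1)

/-- `Δ(μ)` is the sum of the given elementary elements of `K ∘ K`. -/
def IsDecomp {r : ℕ} {n : ℤ} (μ : KRep K r n) (T : List (CompTerm K r)) : Prop :=
  treeMk E 1 _ _ (Finsupp.linearCombination k (cut E) μ.z) = (T.map CompTerm.toTrees).sum

/-- `Δ₍₁₎(μ)` is the sum of the given elementary elements of `K ∘₍₁₎ K`. -/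
def IsInfDecomp {r : ℕ} {n : ℤ} (μ : KRep K r n) (T : List (InfTerm K r)) : Prop :=
  treeMk E 1 _ _ (Finsupp.linearCombination k (infCut E) μ.z) = (T.map InfTerm.toTrees).sum

end Decomposition

namespace QuadraticData

variable {k : Type u} [CommRing k] (P : QuadraticData.{u, v} k)

/-- The corelations `s²R ⊆ s²(E ∘₍₁₎ E) ≅ (sE) ∘₍₁₎ (sE)`; the isomorphism sends
`s²(μ₁ ∘_l μ₂)` to `(-1)^{|μ₁|} sμ₁ ∘_l sμ₂`. -/
noncomputable def corelations (r : ℕ) (n : ℤ) : Submodule k (TreeModule P.E 1 Unit (Fin r)) :=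
  ((P.R r (n - 2)).comap (treeMk P.E 0 _ _) ⊓ weightTwoTrees P.E r).map
    (treeMk P.E 1 _ _ ∘ₗ Finsupp.linearCombination k
      fun t => single t (koszulSgn k t.rootDeg))

/-- `K` is a graded subcooperad of the cofree conilpotent cooperad on `sE` (a sub-`𝕊`-module with
`Δ(K) ⊆ K ∘ K`) whose projection to weight two lies in `s²R`. -/
def IsCorelated (K : ∀ (r : ℕ) (_ : ℤ), Submodule k (TreeModule P.E 1 Unit (Fin r))) : Prop :=
  ∀ (r : ℕ) (n : ℤ), ∀ x ∈ K r n, ∃ z ∈ multilinearTrees P.E 1 r n, treeMk P.E 1 _ _ z = x ∧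
    (∀ σ : Equiv.Perm (Fin r), treeMk P.E 1 _ _ (relabel P.E σ z) ∈ K r n) ∧
    treeMk P.E 1 _ _ (Finsupp.linearCombination k (cut P.E) z) ∈
      Submodule.span k (Set.range (CompTerm.toTrees (K := K) (r := r))) ∧
    treeMk P.E 1 _ _ (z.filter fun t => t.weight = 2) ∈ P.corelations r n

/-- The Koszul dual cooperad `𝒞(sE, s²R)`, in arity `r` and degree `n`: the largest subcooperad of
the cofree conilpotent cooperad on `sE` whose projection to weight two lies in `s²R`. -/
noncomputable def koszulDual (r : ℕ) (n : ℤ) : Submodule k (TreeModule P.E 1 Unit (Fin r)) :=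
  sSup {S | ∃ K, P.IsCorelated K ∧ S = K r n}

end QuadraticData

/-! ### The unit and the generators of the Koszul dual cooperad -/

theorem multiExt_single {k : Type u} [CommRing k] {m : ℕ} {X V : Type*} [AddCommGroup V]
    [Module k V] (g : (Fin m → X) → V) (a : Fin m → X) :
    multiExt k g (fun i => single (a i) 1) = g a := by
  classical
  cases subsingleton_or_nontrivial k with
  | inl h =>
    have := Module.subsingleton k V
    exact Subsingleton.elim _ _
  | inr h =>
    rw [multiExt, Finset.sum_eq_single a]
    · simp
    · intro b hb hne
      refine absurd ?_ hne
      funext i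
      have := Fintype.mem_piFinset.1 hb i
      simpa [Finsupp.support_single] using this
    · intro h'
      refine absurd (Fintype.mem_piFinset.2 fun i => ?_) h'
      simp

theorem koszulExp_eq_zero {κ : Type*} [LT κ] [DecidableRel (α := κ) (· < ·)] (l : List (κ × ℤ))
    (h : ∀ a ∈ l, a.2 = 0) : koszulExp l = 0 := by
  induction l with
  | nil => rfl
  | cons a l ih =>
    rw [koszulExp, ih fun b hb => h b (List.mem_cons_of_mem _ hb), h a List.mem_cons_self]
    simp

theorem flatten_ofFn_singleton {r : ℕ} {X : Type*} (f : Fin r → X) :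
    (List.ofFn fun i => [f i]).flatten = List.ofFn f := by
  induction r with
  | zero => simp
  | succ r ih => simp [List.ofFn_succ, ih]

theorem permExp_zero {r : ℕ} (σ : Equiv.Perm (Fin r)) : permExp σ (fun _ => 0) = 0 :=
  koszulExp_eq_zero _ (by simp)

theorem koszulExp_corolla {E : ℕ → ℤ → Type v} {r : ℕ} {n : ℤ} (e : E r n) :
    koszulExp ((OpTree.corolla e).word 1 fun _ => 0) = 0 := by
  simp only [OpTree.corolla, OpTree.word, koszulExp, flatten_ofFn_singleton]
  rw [koszulExp_eq_zero _ (by simp)]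
  simp [Function.comp_def]

@[simp] theorem koszulSgn_zero (k : Type*) [CommRing k] : koszulSgn k 0 = 1 := by
  simp [koszulSgn]

theorem graft_corolla {k : Type u} [CommRing k] (E : GradedSModule.{u, v} k) {r : ℕ} {n : ℤ}
    {L : Type} (e : E.obj r n) (x : Fin r → OpTree E.obj Bool (Bool × L))
    (hx : ∀ i, (x i).deg 1 = 0) :
    graft E (single (OpTree.corolla e) 1) (fun i => single (x i) 1)
      = single (.node false r n e x) 1 := by
  rw [graft, Finsupp.sum_single_index (by simp), multiExt_single, one_smul]
  simp only [hx, koszulExp_corolla, koszulSgn_zero]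
  rfl

namespace QuadraticData

variable {k : Type u} [CommRing k] (P : QuadraticData.{u, v} k)

/-- The subcollection spanned by the unit and `sE`. -/
noncomputable def lowWeight (r : ℕ) (n : ℤ) : Submodule k (TreeModule P.E 1 Unit (Fin r)) :=
  Submodule.span k ({x | ∃ l : Fin r, r = 1 ∧ n = 0 ∧ x = treeMk P.E 1 _ _ (single (.leaf l) 1)} ∪
    {x | ∃ (m : ℤ) (e : P.E.obj r m), m + 1 = n ∧
      x = treeMk P.E 1 _ _ (single (OpTree.corolla e) 1)})

theorem leaf_mem_multilinearTrees :
    single (.leaf 0) 1 ∈ multilinearTrees P.E 1 1 0 := by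
  refine Finsupp.single_mem_supported k _ ⟨?_, rfl⟩
  simp [OpTree.IsMultilinear, OpTree.leaves, List.finRange_succ]

theorem corolla_mem_multilinearTrees {r : ℕ} {n : ℤ} (e : P.E.obj r n) :
    single (OpTree.corolla e) 1 ∈ multilinearTrees P.E 1 r (n + 1) := by
  refine Finsupp.single_mem_supported k _ ⟨?_, ?_⟩
  · simp only [OpTree.IsMultilinear, OpTree.leaves, OpTree.corolla, flatten_ofFn_singleton]
    rw [List.ofFn_eq_map, List.map_id']
  · simp [OpTree.deg, OpTree.corolla]

/-- The unit, in any subcollection containing it. -/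
noncomputable def repOne (K : ∀ (r : ℕ) (_ : ℤ), Submodule k (TreeModule P.E 1 Unit (Fin r)))
    (h : ∀ r n, P.lowWeight r n ≤ K r n) : KRep K 1 0 where
  z := single (.leaf 0) 1
  homogeneous := P.leaf_mem_multilinearTrees
  mem := h _ _ (Submodule.subset_span (Or.inl ⟨0, rfl, rfl, rfl⟩))

/-- The element `sμ`, in any subcollection containing it. -/
noncomputable def repGen (K : ∀ (r : ℕ) (_ : ℤ), Submodule k (TreeModule P.E 1 Unit (Fin r)))
    (h : ∀ r n, P.lowWeight r n ≤ K r n) {r : ℕ} {n : ℤ} (e : P.E.obj r n) : KRep K r (n + 1) where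
  z := single (OpTree.corolla e) 1
  homogeneous := P.corolla_mem_multilinearTrees e
  mem := h _ _ (Submodule.subset_span (Or.inr ⟨n, e, rfl, rfl⟩))

section

variable (K : ∀ (r : ℕ) (_ : ℤ), Submodule k (TreeModule P.E 1 Unit (Fin r)))
  (h : ∀ r n, P.lowWeight r n ≤ K r n)

/-- The term `(1; μ)` of `Δ(μ)`. -/
noncomputable def termOneLeft {r : ℕ} {n : ℤ} (μ : KRep K r n) : CompTerm K r where
  m := 1
  n := 0
  ν := P.repOne K h
  ar _ := r
  ns _ := n
  νs _ := μ
  lab _ := id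
  lab_bij := ⟨fun p q hpq => by
      obtain ⟨a, b⟩ := p
      obtain ⟨c, d⟩ := q
      obtain rfl := Subsingleton.elim a c
      simpa using hpq, fun b => ⟨⟨0, b⟩, rfl⟩⟩

/-- The term `(μ; 1, ..., 1)` of `Δ(μ)`. -/
noncomputable def termOneRight {r : ℕ} {n : ℤ} (μ : KRep K r n) : CompTerm K r where
  m := r
  n := n
  ν := μ
  ar _ := 1
  ns _ := 0
  νs _ := P.repOne K h
  lab j _ := j
  lab_bij := ⟨fun p q hpq => by
      obtain ⟨a, b⟩ := p
      obtain ⟨c, d⟩ := q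
      obtain rfl : a = c := hpq
      obtain rfl := Subsingleton.elim b d
      rfl, fun b => ⟨⟨b, 0⟩, rfl⟩⟩

theorem termOneLeft_toTrees_leaf :
    (P.termOneLeft K h (P.repOne K h)).toTrees
      = treeMk P.E 1 Bool (Bool × Fin 1) (single (.leaf (true, 0)) 1) := by
  simp only [CompTerm.toTrees, termOneLeft, repOne, graft, Finsupp.mapDomain_single]
  rw [Finsupp.sum_single_index (by simp), multiExt_single]
  simp [OpTree.word, OpTree.map, OpTree.bind, OpTree.paint, OpTree.deg, koszulExp]

theorem termOneLeft_toTrees_gen {r : ℕ} {n : ℤ} (e : P.E.obj r n) :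
    (P.termOneLeft K h (P.repGen K h e)).toTrees
      = treeMk P.E 1 Bool (Bool × Fin r) (single ((OpTree.corolla e).paint true id) 1) := by
  simp only [CompTerm.toTrees, termOneLeft, repOne, repGen, graft, Finsupp.mapDomain_single]
  rw [Finsupp.sum_single_index (by simp), multiExt_single]
  simp [OpTree.word, OpTree.map, OpTree.bind, koszulExp]

theorem termOneRight_toTrees_gen {r : ℕ} {n : ℤ} (e : P.E.obj r n) :
    (P.termOneRight K h (P.repGen K h e)).toTrees
      = treeMk P.E 1 Bool (Bool × Fin r)
        (single (.node false r n e fun i => .leaf (true, i)) 1) := by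
  refine congrArg (treeMk P.E 1 Bool (Bool × Fin r)) (Eq.trans (b := graft P.E
    (single (OpTree.corolla e) 1) fun i : Fin r => single (.leaf (true, i)) 1) ?_ ?_)
  · simp only [termOneRight, repOne, repGen, Finsupp.mapDomain_single, OpTree.paint, OpTree.map]
  · exact graft_corolla P.E e _ fun _ => rfl

theorem cut_corolla {r : ℕ} {n : ℤ} (e : P.E.obj r n) :
    cut P.E (OpTree.corolla e) = single ((OpTree.corolla e).paint true id) 1
      + single (.node false r n e fun i => .leaf (true, i)) 1 := by
  simp only [OpTree.corolla, cut]
  rw [multiExt_single]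

end

theorem relabel_corolla {r : ℕ} {n : ℤ} (e : P.E.obj r n) (σ : Equiv.Perm (Fin r)) :
    treeMk P.E 1 _ _ (relabel P.E σ (single (OpTree.corolla e) 1))
      = treeMk P.E 1 _ _ (single (OpTree.corolla (P.E.act σ e)) 1) := by
  have h := Submodule.subset_span (R := k)
    (TreeRel.perm (E := P.E) (s := 1) (C := Unit) (L := Fin r) () r n σ e .leaf)
  have h' := (Submodule.Quotient.mk_eq_zero (treeRel P.E 1 Unit (Fin r))).2 h
  rw [Submodule.Quotient.mk_sub, sub_eq_zero] at h'
  simp only [OpTree.deg, permExp_zero, koszulSgn_zero] at h'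
  simp only [relabel, Finsupp.lmapDomain_apply, Finsupp.mapDomain_single, OpTree.corolla,
    OpTree.map]
  exact h'.symm

theorem isCorelated_lowWeight : P.IsCorelated P.lowWeight := by
  intro r n x hx
  induction hx using Submodule.span_induction with
  | mem x hx =>
    rcases hx with ⟨l, rfl, rfl, rfl⟩ | ⟨m, e, rfl, rfl⟩
    · obtain rfl := Subsingleton.elim 0 l
      refine ⟨_, P.leaf_mem_multilinearTrees, rfl, fun σ => ?_, ?_, ?_⟩
      · refine Submodule.subset_span (Or.inl ⟨0, rfl, rfl, ?_⟩)
        simp only [relabel, Finsupp.lmapDomain_apply, Finsupp.mapDomain_single, OpTree.map]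
        rw [Subsingleton.elim (σ.symm 0) 0]
      · refine Submodule.subset_span
          ⟨P.termOneLeft _ (fun _ _ => le_rfl) (P.repOne _ fun _ _ => le_rfl), ?_⟩
        rw [termOneLeft_toTrees_leaf]
        simp [cut]
      · rw [Finsupp.filter_single_of_neg _ (by simp [OpTree.weight]), map_zero]
        exact zero_mem _
    · refine ⟨_, P.corolla_mem_multilinearTrees e, rfl, fun σ => ?_, ?_, ?_⟩
      · rw [relabel_corolla]
        exact Submodule.subset_span (Or.inr ⟨m, _, rfl, rfl⟩)
      · rw [Finsupp.linearCombination_single, one_smul, cut_corolla, map_add]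
        refine add_mem (Submodule.subset_span
          ⟨P.termOneLeft _ (fun _ _ => le_rfl) (P.repGen _ (fun _ _ => le_rfl) e), ?_⟩)
          (Submodule.subset_span
          ⟨P.termOneRight _ (fun _ _ => le_rfl) (P.repGen _ (fun _ _ => le_rfl) e), ?_⟩)
        · rw [termOneLeft_toTrees_gen]
        · rw [termOneRight_toTrees_gen]
      · rw [Finsupp.filter_single_of_neg _ (by simp [OpTree.weight, OpTree.corolla]), map_zero]
        exact zero_mem _
  | zero =>
    refine ⟨0, zero_mem _, map_zero _, fun σ => ?_, ?_, ?_⟩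
    · rw [map_zero, map_zero]
      exact zero_mem _
    · rw [map_zero, map_zero]
      exact zero_mem _
    · rw [show Finsupp.filter _ (0 : OpTree P.E.obj Unit (Fin r) →₀ k) = 0 from
        Finsupp.ext fun t => by simp [Finsupp.filter_apply], map_zero]
      exact zero_mem _
  | add x y _ _ hx hy =>
    obtain ⟨z, h1, rfl, h3, h4, h5⟩ := hx
    obtain ⟨z', h1', rfl, h3', h4', h5'⟩ := hy
    refine ⟨z + z', add_mem h1 h1', map_add _ _ _, fun σ => ?_, ?_, ?_⟩
    · rw [map_add, map_add]
      exact add_mem (h3 σ) (h3' σ)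
    · rw [map_add, map_add]
      exact add_mem h4 h4'
    · rw [Finsupp.filter_add, map_add]
      exact add_mem h5 h5'
  | smul a x _ hx =>
    obtain ⟨z, h1, rfl, h3, h4, h5⟩ := hx
    refine ⟨a • z, Submodule.smul_mem _ a h1, map_smul _ _ _, fun σ => ?_, ?_, ?_⟩
    · rw [map_smul, map_smul]
      exact Submodule.smul_mem _ a (h3 σ)
    · rw [map_smul, map_smul]
      exact Submodule.smul_mem _ a h4
    · rw [Finsupp.filter_smul, map_smul]
      exact Submodule.smul_mem _ a h5

theorem lowWeight_le (r : ℕ) (n : ℤ) : P.lowWeight r n ≤ P.koszulDual r n :=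
  le_sSup ⟨_, P.isCorelated_lowWeight, rfl⟩

/-- The unit `1` of the Koszul dual cooperad. -/
noncomputable def one : KRep P.koszulDual 1 0 := P.repOne _ P.lowWeight_le

/-- The element `sμ` of the Koszul dual cooperad, for `μ ∈ E(r)`. -/
noncomputable def gen {r : ℕ} {n : ℤ} (μ : P.E.obj r n) : KRep P.koszulDual r (n + 1) :=
  P.repGen _ P.lowWeight_le μ

end QuadraticData

/-! ### Derived homotopy algebras -/

/-- A bigrading `M = ⨁ M_{p,q}` concentrated in horizontal degrees `p ≥ 0`. -/
structure Bigrading (k : Type u) [CommRing k] (M : Type w) [AddCommGroup M] [Module k M] where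
  gr : ℤ × ℤ → Submodule k M
  dec : DirectSum.Decomposition gr
  nonneg : ∀ p q, p < 0 → gr (p, q) = ⊥

namespace Bigrading

variable {k : Type u} [CommRing k] {M : Type w} [AddCommGroup M] [Module k M] (G : Bigrading k M)

/-- The part `F_m M_n = ⨁_{p + q = n, p ≤ m} M_{p,q}` of filtration `m` and total degree `n`. -/
def filt (m n : ℤ) : Submodule k M := ⨆ p ∈ Set.Iic m, G.gr (p, n - p)

/-- The part `M_n = ⨁_{p + q = n} M_{p,q}` of total degree `n`. -/
def tot (n : ℤ) : Submodule k M := ⨆ p, G.gr (p, n - p)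

/-- The component of bidegree `b`. -/
noncomputable def comp (b : ℤ × ℤ) : M →ₗ[k] M :=
  letI := G.dec
  (G.gr b).subtype ∘ₗ DirectSum.component k _ (fun b => G.gr b) b ∘ₗ
    (DirectSum.decomposeLinearEquiv G.gr).toLinearMap

/-- The component of bidegree `s` of a linear map: it sends `x` of bidegree `b` to the component of
bidegree `b + s` of `g x`. -/
noncomputable def linPiece {N : Type*} [AddCommGroup N] [Module k N] (G : Bigrading k M)
    (H : Bigrading k N) (g : M →ₗ[k] N) (s : ℤ × ℤ) : M →ₗ[k] N :=
  letI := G.dec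
  DirectSum.toModule k _ N (fun b => H.comp (b + s) ∘ₗ g ∘ₗ (G.gr b).subtype) ∘ₗ
    (DirectSum.decomposeLinearEquiv G.gr).toLinearMap

/-- The numerator `{x ∈ F_p M_n | d x ∈ F_{p-2} M_{n-1}}` of the term in filtration `p` and total
degree `n` of the `E²` page of the spectral sequence of the filtered complex `(M, d)`. -/
def cycles₂ (d : M →ₗ[k] M) (p n : ℤ) : Submodule k M :=
  G.filt p n ⊓ (G.filt (p - 2) (n - 1)).comap d

/-- The denominator `{x ∈ F_{p-1} M_n | d x ∈ F_{p-2} M_{n-1}} + d {y ∈ F_{p+1} M_{n+1} | d y ∈ F_p M_n}`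
of the term in filtration `p` and total degree `n` of the `E²` page. -/
def boundaries₂ (d : M →ₗ[k] M) (p n : ℤ) : Submodule k M :=
  (G.filt (p - 1) n ⊓ (G.filt (p - 2) (n - 1)).comap d) ⊔
    (G.filt (p + 1) (n + 1) ⊓ (G.filt p n).comap d).map d

end Bigrading

/-- A family of `k`-linear maps `𝒪^¡(r)_n ⊗ M^{⊗ r} → N`, where `𝒪^¡` is the Koszul dual cooperad. -/
abbrev OpFamily {k : Type u} [CommRing k] (P : QuadraticData.{u, v} k) (M N : Type*)
    [AddCommGroup M] [Module k M] [AddCommGroup N] [Module k N] :=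
  ∀ (r : ℕ) (n : ℤ), P.koszulDual r n →ₗ[k] MultilinearMap k (fun _ : Fin r => M) N

section Evaluation

variable {k : Type u} [CommRing k] {P : QuadraticData.{u, v} k}
  {M N : Type*} [AddCommGroup M] [Module k M] [AddCommGroup N] [Module k N]

/-- `± a(x_{σ⁻¹(1)}, ..., b(x_{σ⁻¹(l)}, ...), ...)`, with `a` acting through `φ` and `b` acting
through the degree `-1` family `ψ`. The exponent of the sign is
`η₁ = α_σ + |a| + (|b| + 1) ∑_{m < l} |x_{σ⁻¹(m)}|`. Here `deg i = |x_i|`. -/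
noncomputable def InfTerm.eval {r : ℕ} (T : InfTerm P.koszulDual r) (φ : OpFamily P M N)
    (ψ : OpFamily P M M) (deg : Fin r → ℤ) (x : Fin r → M) : N :=
  koszulSgn k
    (koszulExp ((List.ofFn fun j => if h : j = T.l then List.ofFn T.labB
        else [T.labA ⟨j, h⟩]).flatten.map fun i => (i, deg i))
      + T.nA + (T.nB + 1) * sumBefore (fun j => if h : j = T.l then 0 else deg (T.labA ⟨j, h⟩)) T.l) •
    φ T.rA T.nA T.a.elt fun j =>
      if h : j = T.l then ψ T.rB T.nB T.b.elt fun p => x (T.labB p) else x (T.labA ⟨j, h⟩)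

/-- `± ν(f(ν₁)(x_{σ⁻¹(1)}, ...), ..., f(ν_m)(..., x_{σ⁻¹(r)}))`, with `ν` acting through `φ` and `f` of
degree `0`. The exponent of the sign is `α_σ` plus the sum over `j` of `|ν_j|` times the sum of the
degrees of the inputs of `ν₁, ..., ν_{j-1}`. -/
noncomputable def CompTerm.eval {r : ℕ} (T : CompTerm P.koszulDual r) (φ : OpFamily P N N)
    (f : OpFamily P M N) (deg : Fin r → ℤ) (x : Fin r → M) : N :=
  koszulSgn k
    (koszulExp ((List.ofFn fun j => List.ofFn (T.lab j)).flatten.map fun i => (i, deg i))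
      + ∑ j, T.ns j * sumBefore (fun j' => ∑ p, deg (T.lab j' p)) j) •
    φ T.m T.n T.ν.elt fun j => f (T.ar j) (T.ns j) (T.νs j).elt fun p => x (T.lab j p)

/-- Compatibility with the right actions of the symmetric groups:
`(μ · σ)(x₁, ..., x_r) = (-1)^{α_σ} μ(x_{σ⁻¹(1)}, ..., x_{σ⁻¹(r)})` for `x_i` of total degree `|x_i|`. -/
def OpFamily.IsEquivariant (φ : OpFamily P M N) (G : Bigrading k M) : Prop :=
  ∀ (r : ℕ) (n : ℤ) (σ : Equiv.Perm (Fin r)) (μ μ' : KRep P.koszulDual r n),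
    μ'.z = relabel P.E σ μ.z → ∀ (deg : Fin r → ℤ) (x : Fin r → M), (∀ i, x i ∈ G.tot (deg i)) →
      φ r n μ'.elt x = koszulSgn k (permExp σ deg) • φ r n μ.elt fun i => x (σ.symm i)

/-- The family is homogeneous of degree `s` and compatible with the filtrations: it restricts to
`𝒪^¡(r)_n ⊗ F_{m₁} M_{n₁} ⊗ ⋯ ⊗ F_{m_r} M_{n_r} → F_{m₁ + ⋯ + m_r} N_{s + n + n₁ + ⋯ + n_r}`. -/
def OpFamily.IsFiltered (φ : OpFamily P M N) (G : Bigrading k M) (H : Bigrading k N) (s : ℤ) :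
    Prop :=
  ∀ (r : ℕ) (n : ℤ) (μ : P.koszulDual r n) (m deg : Fin r → ℤ) (x : Fin r → M),
    (∀ i, x i ∈ G.filt (m i) (deg i)) → φ r n μ x ∈ H.filt (∑ i, m i) (s + n + ∑ i, deg i)

/-- `∑ i, (-1)^(|x_1| + ⋯ + |x_{i-1}|) g(x_1, ..., d x_i, ..., x_r)`. -/
noncomputable def sumDiff {r : ℕ} (g : (Fin r → M) → N) (d : M →ₗ[k] M) (deg : Fin r → ℤ)
    (x : Fin r → M) : N :=
  ∑ i, koszulSgn k (sumBefore deg i) • g (Function.update x i (d (x i)))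

end Evaluation

/-- A bigraded module with an endomorphism and operations parametrized by the Koszul dual cooperad:
the data of a derived homotopy algebra. -/
structure DerivedOps {k : Type u} [CommRing k] (P : QuadraticData.{u, v} k) (M : Type w)
    [AddCommGroup M] [Module k M] extends Bigrading k M where
  d : M →ₗ[k] M
  op : OpFamily P M M

namespace DerivedOps

variable {k : Type u} [CommRing k] {P : QuadraticData.{u, v} k} {M : Type w} [AddCommGroup M]
  [Module k M] (S : DerivedOps P M)

/-- The piece `d_i : M_{p,q} → M_{p-i,q-1+i}` of the differential. -/
noncomputable def dPiece (i : ℤ) : M →ₗ[k] M :=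
  S.toBigrading.linPiece S.toBigrading S.d (-i, -1 + i)

/-- The piece `μ_i(x₁, ..., x_r)` of bidegree `(p₁ + ⋯ + p_r - i, n - 1 + q₁ + ⋯ + q_r + i)` of
`μ(x₁, ..., x_r)`, where `|μ| = n` and `x_j` has bidegree `b j = (p_j, q_j)`. -/
noncomputable def opPiece (i : ℤ) {r : ℕ} {n : ℤ} (μ : KRep P.koszulDual r n) (b : Fin r → ℤ × ℤ)
    (x : Fin r → M) : M :=
  S.comp (∑ j, b j + (-i, n - 1 + i)) (S.op r n μ.elt x)

end DerivedOps

/-- A derived homotopy `𝒪`-algebra, for `𝒪 = 𝒫(E, R)`: a homotopy `𝒪`-algebra whose underlying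
complex is split filtered and whose structure maps are compatible with the filtration. -/
structure DerivedHomotopyAlgebra {k : Type u} [CommRing k] (P : QuadraticData.{u, v} k)
    (M : Type w) [AddCommGroup M] [Module k M] extends DerivedOps P M where
  d_mem : ∀ m n, ∀ x ∈ toBigrading.filt m n, d x ∈ toBigrading.filt m (n - 1)
  d_d : ∀ x, d (d x) = 0
  filtered : op.IsFiltered toBigrading toBigrading (-1)
  equivariant : op.IsEquivariant toBigrading
  op_one : op 1 0 P.one.elt = 0
  op_eq : ∀ {r : ℕ} {n : ℤ} (μ : KRep P.koszulDual r n) (T : List (InfTerm P.koszulDual r)),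
    IsInfDecomp μ T → ∀ (deg : Fin r → ℤ) (x : Fin r → M),
      (∀ i, x i ∈ toBigrading.tot (deg i)) →
      d (op r n μ.elt x) - koszulSgn k (n - 1) • sumDiff (op r n μ.elt) d deg x
        + (T.map fun t => t.eval op op deg x).sum = 0

/-- A derived `∞`-morphism between derived homotopy algebras. -/
structure DerivedInfMorphism {k : Type u} [CommRing k] {P : QuadraticData.{u, v} k}
    {M N : Type*} [AddCommGroup M] [Module k M] [AddCommGroup N] [Module k N]
    (S : DerivedOps P M) (S' : DerivedOps P N) where
  map : OpFamily P M N
  filtered : map.IsFiltered S.toBigrading S'.toBigrading 0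
  equivariant : map.IsEquivariant S.toBigrading
  map_eq : ∀ {r : ℕ} {n : ℤ} (μ : KRep P.koszulDual r n) (T₁ : List (InfTerm P.koszulDual r))
    (T : List (CompTerm P.koszulDual r)), IsInfDecomp μ T₁ → IsDecomp μ T →
      ∀ (deg : Fin r → ℤ) (x : Fin r → M), (∀ i, x i ∈ S.toBigrading.tot (deg i)) →
      S'.d (map r n μ.elt x) - koszulSgn k n • sumDiff (map r n μ.elt) S.d deg x
        = (T₁.map fun t => t.eval map S.op deg x).sum - (T.map fun t => t.eval S'.op map deg x).sum

/-! ### Differential graded algebras -/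

/-- The operation given by a tree, without signs. -/
def OpTree.eval {E : ℕ → ℤ → Type v} {C L : Type} {A : Type*}
    (act : ∀ (r : ℕ) (n : ℤ), E r n → (Fin r → A) → A) (x : L → A) : OpTree E C L → A
  | .leaf l => x l
  | .node _ r n e ch => act r n e fun i => (ch i).eval act x

/-- A differential graded `𝒪`-algebra, for `𝒪 = 𝒫(E, R)`: a complex with operations parametrized by
`E` which are compatible with the differential and satisfy the relations in `R`. -/
structure DGAlgebra {k : Type u} [CommRing k] (P : QuadraticData.{u, v} k) (A : Type w)
    [AddCommGroup A] [Module k A] where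
  gr : ℤ → Submodule k A
  dec : DirectSum.Decomposition gr
  d : A →ₗ[k] A
  d_mem : ∀ n, ∀ x ∈ gr n, d x ∈ gr (n - 1)
  d_d : ∀ x, d (d x) = 0
  op : ∀ (r : ℕ) (n : ℤ), P.E.obj r n →ₗ[k] MultilinearMap k (fun _ : Fin r => A) A
  op_mem : ∀ {r : ℕ} {n : ℤ} (μ : P.E.obj r n) (deg : Fin r → ℤ) (x : Fin r → A),
    (∀ i, x i ∈ gr (deg i)) → op r n μ x ∈ gr (n + ∑ i, deg i)
  op_act : ∀ {r : ℕ} {n : ℤ} (σ : Equiv.Perm (Fin r)) (μ : P.E.obj r n) (deg : Fin r → ℤ)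
    (x : Fin r → A), (∀ i, x i ∈ gr (deg i)) →
      op r n (P.E.act σ μ) x = koszulSgn k (permExp σ deg) • op r n μ fun i => x (σ.symm i)
  op_d : ∀ {r : ℕ} {n : ℤ} (μ : P.E.obj r n) (deg : Fin r → ℤ) (x : Fin r → A),
    (∀ i, x i ∈ gr (deg i)) → d (op r n μ x) = koszulSgn k n • sumDiff (op r n μ) d deg x
  op_rel : ∀ {r : ℕ} {n : ℤ}, ∀ z ∈ multilinearTrees P.E 0 r n ⊓ weightTwoTrees P.E r,
    treeMk P.E 0 _ _ z ∈ P.R r n → ∀ (deg : Fin r → ℤ) (x : Fin r → A),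
      (∀ i, x i ∈ gr (deg i)) → (z.sum fun t a =>
        (a * koszulSgn k (koszulExp (t.word 0 deg))) • t.eval (fun r n e => op r n e) x) = 0

section Strict

variable {k : Type u} [CommRing k] {P : QuadraticData.{u, v} k} {A : Type w} [AddCommGroup A]
  [Module k A]

/-- A graded module regarded as a bigraded module concentrated in horizontal degree `0`. -/
def horizontalGr (gr : ℤ → Submodule k A) (b : ℤ × ℤ) : Submodule k A :=
  if b.1 = 0 then gr b.2 else ⊥

theorem horizontalGr_zero (gr : ℤ → Submodule k A) (n : ℤ) : horizontalGr gr (0, n) = gr n := rfl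

/-- The map that decomposes an element of a graded module regarded as a bigraded module. -/
noncomputable def horizontalDecompose (gr : ℤ → Submodule k A) (dec : DirectSum.Decomposition gr) :
    A →ₗ[k] DirectSum (ℤ × ℤ) fun b => horizontalGr gr b :=
  letI := dec
  DirectSum.toModule k ℤ _ (fun n => DirectSum.lof k (ℤ × ℤ) (fun b => horizontalGr gr b) (0, n) ∘ₗ
      Submodule.inclusion (horizontalGr_zero gr n).ge) ∘ₗ (DirectSum.decomposeLinearEquiv gr).toLinearMap

theorem horizontalDecompose_apply (gr : ℤ → Submodule k A) (dec : DirectSum.Decomposition gr)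
    (n : ℤ) (x : A) (hx : x ∈ gr n) : horizontalDecompose gr dec x =
      DirectSum.lof k (ℤ × ℤ) (fun b => horizontalGr gr b) (0, n) ⟨x, hx⟩ := by
  let := dec
  simp only [horizontalDecompose, LinearMap.comp_apply, LinearEquiv.coe_coe,
    DirectSum.decomposeLinearEquiv_apply]
  rw [DirectSum.decompose_of_mem gr hx, ← DirectSum.lof_eq_of k, DirectSum.toModule_lof]
  rfl

/-- The decomposition of a graded module regarded as a bigraded module. -/
@[reducible] noncomputable def horizontalDec (gr : ℤ → Submodule k A)
    (dec : DirectSum.Decomposition gr) : DirectSum.Decomposition (horizontalGr gr) :=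
  DirectSum.Decomposition.ofLinearMap (horizontalGr gr) (horizontalDecompose gr dec)
    (by
      let := dec
      ext x
      induction x using DirectSum.Decomposition.inductionOn gr with
      | zero => simp
      | @homogeneous m y =>
        rw [LinearMap.comp_apply, horizontalDecompose_apply gr dec m y y.2,
          DirectSum.coeLinearMap_lof]
        rfl
      | add m m' h h' => rw [map_add, h, h', map_add])
    (by
      refine DirectSum.linearMap_ext _ fun b => LinearMap.ext fun x => ?_
      obtain ⟨p, n⟩ := b
      obtain ⟨x, hx⟩ := x
      by_cases hp : p = 0
      · subst hp
        simp only [LinearMap.comp_apply, DirectSum.coeLinearMap_lof, LinearMap.id_apply]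
        exact horizontalDecompose_apply gr dec n x hx
      · have h0 : x = 0 := by
          simpa [horizontalGr, hp] using hx
        subst h0
        have : (⟨0, hx⟩ : horizontalGr gr (p, n)) = 0 := rfl
        rw [this, map_zero, map_zero])

open scoped Classical in
/-- The operation of weight one given by a tree: if it is the tree of `μ · σ`, with `μ` in `E`, then
it is the operation `μ · σ`, and otherwise it vanishes. -/
noncomputable def DGAlgebra.treeOp (𝒜 : DGAlgebra P A) {r : ℕ} :
    OpTree P.E.obj Unit (Fin r) → MultilinearMap k (fun _ : Fin r => A) A
  | .leaf _ => 0
  | .node _ m n e ch =>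
    if h : ∃ τ : Fin m ≃ Fin r, ∀ i, ch i = .leaf (τ i) then
      (𝒜.op m n (P.E.act ((finCongr (Fin.equiv_iff_eq.1 ⟨h.choose⟩)).trans h.choose.symm) e)).domDomCongr
        (finCongr (Fin.equiv_iff_eq.1 ⟨h.choose⟩))
    else 0

theorem DGAlgebra.treeOp_lift_eq_zero (𝒜 : DGAlgebra P A) {r : ℕ}
    (z : OpTree P.E.obj Unit (Fin r) →₀ k) (hz : TreeRel P.E 1 Unit (Fin r) z) :
    Finsupp.linearCombination k 𝒜.treeOp z = 0 := by
  have key : ∀ (g : OpTree P.E.obj Unit (Fin r) → MultilinearMap k (fun _ : Fin r => A) A),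
      (∀ c m n e ch, g (.node c m n e ch) = 0) → ∀ z, TreeRel P.E 1 Unit (Fin r) z →
        Finsupp.linearCombination k g z = 0 := by
    intro g hg z hz
    induction hz with
    | add => simp [hg]
    | smul => simp [hg]
    | perm => simp [hg]
    | congr c m n e ch i z hz ih =>
      rw [Finsupp.linearCombination_mapDomain]
      have : (g ∘ fun t => OpTree.node c m n e (Function.update ch i t)) = fun _ => 0 :=
        funext fun t => hg ..
      rw [this]
      simp [Finsupp.linearCombination_apply]
  cases hz with
  | add c m n e e' ch =>
    simp only [map_sub, Finsupp.linearCombination_single, one_smul, treeOp]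
    split_ifs with h
    · ext x
      simp
    · simp
  | smul c m n a e ch =>
    simp only [map_sub, Finsupp.linearCombination_single, one_smul, treeOp]
    split_ifs with h
    · ext x
      simp
    · simp
  | perm c m n σ e ch =>
    simp only [map_sub, Finsupp.linearCombination_single, one_smul, treeOp]
    by_cases h : ∃ τ : Fin m ≃ Fin r, ∀ i, ch i = .leaf (τ i)
    · have h' : ∃ τ : Fin m ≃ Fin r, ∀ i, ch (σ.symm i) = .leaf (τ i) :=
        ⟨σ.symm.trans h.choose, fun i => h.choose_spec _⟩
      have hch : h'.choose = σ.symm.trans h.choose := by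
        ext i
        have h1 := h'.choose_spec i
        rw [h.choose_spec] at h1
        exact congrArg Fin.val (OpTree.leaf.inj h1).symm
      have h0 : (fun i => (ch i).deg 1) = fun _ => 0 := by
        funext i
        rw [h.choose_spec i]
        rfl
      rw [dif_pos h, dif_pos h', h0, permExp_zero, koszulSgn_zero, one_smul, sub_eq_zero,
        ← P.E.act_mul, hch]
      rfl
    · have h' : ¬ ∃ τ : Fin m ≃ Fin r, ∀ i, ch (σ.symm i) = .leaf (τ i) := by
        rintro ⟨τ, hτ⟩
        exact h ⟨σ.trans τ, fun i => by simpa using hτ (σ i)⟩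
      rw [dif_neg h, dif_neg h', smul_zero, sub_zero]
  | congr c m n e ch i z hz =>
    rw [Finsupp.linearCombination_mapDomain]
    refine key _ (fun c' m' n' e' ch' => ?_) z hz
    simp only [Function.comp_apply, treeOp]
    rw [dif_neg]
    rintro ⟨τ, hτ⟩
    simpa using hτ i

/-- The action of the Koszul dual cooperad through `κ : 𝒪^¡ → sE → E → 𝒪`. -/
noncomputable def DGAlgebra.kappaOp (𝒜 : DGAlgebra P A) : OpFamily P A A := fun r n =>
  (treeRel P.E 1 Unit (Fin r)).liftQ (Finsupp.linearCombination k 𝒜.treeOp)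
    (Submodule.span_le.2 fun z hz => 𝒜.treeOp_lift_eq_zero z hz) ∘ₗ (P.koszulDual r n).subtype

/-- A differential graded `𝒪`-algebra regarded as a derived homotopy `𝒪`-algebra concentrated in
horizontal degree `0`: `sμ` acts as `μ` for `μ` in `E`, and the elements of weight different from
one act trivially. -/
noncomputable def DGAlgebra.toDerivedOps (𝒜 : DGAlgebra P A) : DerivedOps P A where
  gr := horizontalGr 𝒜.gr
  dec := horizontalDec 𝒜.gr 𝒜.dec
  nonneg p q hp := by simp [horizontalGr, hp.ne]
  d := 𝒜.d
  op := 𝒜.kappaOp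

end Strict

/-! ### Homology and torsion Massey products -/

namespace DGAlgebra

variable {k : Type u} [CommRing k] {P : QuadraticData.{u, v} k} {A : Type w} [AddCommGroup A]
  [Module k A] (𝒜 : DGAlgebra P A)

/-- The homology of the underlying complex. -/
abbrev Homology : Type w :=
  LinearMap.ker 𝒜.d ⧸ (LinearMap.range 𝒜.d).submoduleOf (LinearMap.ker 𝒜.d)

/-- The projection from cycles to homology. -/
abbrev homologyMk : LinearMap.ker 𝒜.d →ₗ[k] 𝒜.Homology :=
  ((LinearMap.range 𝒜.d).submoduleOf (LinearMap.ker 𝒜.d)).mkQ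

/-- The degree `n` homology. -/
def homologyDeg (n : ℤ) : Submodule k 𝒜.Homology :=
  ((𝒜.gr n).submoduleOf (LinearMap.ker 𝒜.d)).map 𝒜.homologyMk

/-- `a` is a cycle with homology class `h`. -/
def Represents (a : A) (h : 𝒜.Homology) : Prop :=
  ∃ ha : a ∈ LinearMap.ker 𝒜.d, 𝒜.homologyMk ⟨a, ha⟩ = h

/-- The indeterminacy `∑ i, μ(x₁, ..., x_{i-1}, H_{|x_i| + 1}(A), x_{i+1}, ..., x_r)`, where
`|x_i| = deg i` and the operation `μ` on homology is computed on representing cycles. -/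
def indeterminacy {r : ℕ} {n : ℤ} (μ : P.E.obj r n) (deg : Fin r → ℤ) (x : Fin r → 𝒜.Homology) :
    Submodule k 𝒜.Homology :=
  Submodule.span k {h | ∃ (i : Fin r) (y : Fin r → A),
    (∀ j, j ≠ i → y j ∈ 𝒜.gr (deg j) ∧ 𝒜.Represents (y j) (x j)) ∧
    y i ∈ 𝒜.gr (deg i + 1) ∧ 𝒜.d (y i) = 0 ∧ 𝒜.Represents (𝒜.op r n μ y) h}

/-- The torsion Massey product `⟨μ; t⟩(x₁, ..., x_r)`, regarded as a coset of the indeterminacy: the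
classes which differ by an element of the indeterminacy from the class of
`∑ i, (-1)^(|μ| + |x_1| + ⋯ + |x_{i-1}|) μ(y_1, ..., z_i, ..., y_r)`, where `y_i` is a cycle
representing `x_i` and `d z_i = t_i y_i`. -/
def torsionMassey {r : ℕ} {n : ℤ} (μ : P.E.obj r n) (t : Fin r → k) (deg : Fin r → ℤ)
    (x : Fin r → 𝒜.Homology) : Set 𝒜.Homology :=
  {h | ∃ (y z : Fin r → A) (h₀ : 𝒜.Homology),
    (∀ i, y i ∈ 𝒜.gr (deg i) ∧ 𝒜.Represents (y i) (x i)) ∧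
    (∀ i, z i ∈ 𝒜.gr (deg i + 1) ∧ 𝒜.d (z i) = t i • y i) ∧
    𝒜.Represents (∑ i, koszulSgn k (n + sumBefore deg i) • 𝒜.op r n μ (Function.update y i (z i))) h₀ ∧
    h - h₀ ∈ 𝒜.indeterminacy μ deg x}

end DGAlgebra

/-! ### Minimal models -/

namespace DerivedInfMorphism

variable {k : Type u} [CommRing k] {P : QuadraticData.{u, v} k}

section General

variable {M N : Type*} [AddCommGroup M] [Module k M] [AddCommGroup N] [Module k N]
  {S : DerivedOps P M} {S' : DerivedOps P N} (f : DerivedInfMorphism S S')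

/-- The underlying morphism `f(1)`. -/
noncomputable def linear : M →ₗ[k] N :=
  (MultilinearMap.ofSubsingleton k M N (0 : Fin 1)).symm (f.map 1 0 P.one.elt)

/-- The piece `f(1)₀`, which preserves the bidegree. -/
noncomputable def linear₀ : M →ₗ[k] N :=
  S.toBigrading.linPiece S'.toBigrading f.linear (0, 0)

/-- `f` is an `E²`-equivalence: it induces an isomorphism between the `E²` pages of the spectral
sequences of the underlying filtered complexes, i.e. the map that it induces between the quotients
`cycles₂ / boundaries₂` is injective and surjective. -/
def IsE2Equivalence : Prop :=
  ∀ p n : ℤ,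
    (∀ x ∈ S.toBigrading.cycles₂ S.d p n,
      f.linear x ∈ S'.toBigrading.boundaries₂ S'.d p n → x ∈ S.toBigrading.boundaries₂ S.d p n) ∧
    (∀ y ∈ S'.toBigrading.cycles₂ S'.d p n, ∃ x ∈ S.toBigrading.cycles₂ S.d p n,
      y - f.linear x ∈ S'.toBigrading.boundaries₂ S'.d p n)

end General

variable {M A : Type*} [AddCommGroup M] [Module k M] [AddCommGroup A] [Module k A]
  {ℳ : DerivedHomotopyAlgebra P M} {𝒜 : DGAlgebra P A}

/-- `f : ℳ ⇝ 𝒜` is a (derived) minimal model of the differential graded algebra `𝒜`. -/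
structure IsMinimalModel (f : DerivedInfMorphism ℳ.toDerivedOps 𝒜.toDerivedOps) : Prop where
  minimal : ℳ.dPiece 0 = 0
  projective : ∀ b, Module.Projective k (ℳ.gr b)
  equivalence : f.IsE2Equivalence

end DerivedInfMorphism

/-! ### The horizontal resolution given by a minimal model -/

namespace Bigrading

variable {k : Type u} [CommRing k] {M N : Type*} [AddCommGroup M] [Module k M] [AddCommGroup N]
  [Module k N] (G : Bigrading k M) (H : Bigrading k N)

theorem comp_of_mem {b : ℤ × ℤ} {x : M} (hx : x ∈ G.gr b) : G.comp b x = x := by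
  let := G.dec
  simp only [comp, LinearMap.comp_apply, LinearEquiv.coe_coe, DirectSum.decomposeLinearEquiv_apply,
    Submodule.coe_subtype]
  exact DirectSum.decompose_of_mem_same G.gr hx

theorem comp_mem (b : ℤ × ℤ) (x : M) : G.comp b x ∈ G.gr b :=
  Submodule.coe_mem _

theorem linPiece_of_mem (g : M →ₗ[k] N) (s : ℤ × ℤ) {b : ℤ × ℤ} {x : M} (hx : x ∈ G.gr b) :
    G.linPiece H g s x = H.comp (b + s) (g x) := by
  let := G.dec
  simp only [linPiece, LinearMap.comp_apply, LinearEquiv.coe_coe,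
    DirectSum.decomposeLinearEquiv_apply]
  rw [DirectSum.decompose_of_mem G.gr hx, ← DirectSum.lof_eq_of k, DirectSum.toModule_lof]
  rfl

theorem induction_on {p : M → Prop} (x : M) (zero : p 0) (hom : ∀ b, ∀ x ∈ G.gr b, p x)
    (add : ∀ x y, p x → p y → p (x + y)) : p x := by
  let := G.dec
  induction x using DirectSum.Decomposition.inductionOn G.gr with
  | zero => exact zero
  | homogeneous y => exact hom _ _ y.2
  | add x y hx hy => exact add x y hx hy

theorem filt_zero (n : ℤ) : G.filt 0 n = G.gr (0, n) := by
  refine le_antisymm (iSup₂_le fun p hp => ?_) ?_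
  · rcases (show p ≤ 0 from hp).lt_or_eq with h | rfl
    · rw [G.nonneg _ _ h]
      exact bot_le
    · simp
  · exact le_trans (by simp) (le_iSup₂_of_le (f := fun p (_ : p ∈ Set.Iic (0 : ℤ)) => G.gr (p, n - p))
      0 (Set.mem_Iic.2 le_rfl) le_rfl)

theorem filt_le_tot (m n : ℤ) : G.filt m n ≤ G.tot n :=
  iSup₂_le fun p _ => le_iSup (fun p => G.gr (p, n - p)) p

end Bigrading

namespace DerivedInfMorphism

variable {k : Type u} [CommRing k] {P : QuadraticData.{u, v} k}
  {M A : Type*} [AddCommGroup M] [Module k M] [AddCommGroup A] [Module k A]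
  {ℳ : DerivedHomotopyAlgebra P M} {𝒜 : DGAlgebra P A}

/-- The infinitesimal decomposition of the unit. -/
noncomputable def infTermOne (P : QuadraticData.{u, v} k) : InfTerm P.koszulDual 1 where
  rA := 1
  nA := 0
  a := P.one
  rB := 1
  nB := 0
  b := P.one
  l := 0
  labA j := absurd (Subsingleton.elim j.1 0) j.2
  labB := id
  lab_bij := ⟨by
      rintro (⟨a, ha⟩ | a) (⟨b, hb⟩ | b) h
      · exact absurd (Subsingleton.elim a 0) ha
      · exact absurd (Subsingleton.elim a 0) ha
      · exact absurd (Subsingleton.elim b 0) hb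
      · simpa using h, fun b => ⟨Sum.inr b, rfl⟩⟩

theorem isInfDecomp_one : IsInfDecomp P.one [infTermOne P] := by
  simp only [IsInfDecomp, List.map_cons, List.map_nil, List.sum_cons, List.sum_nil, add_zero,
    QuadraticData.one, QuadraticData.repOne, Finsupp.linearCombination_single, one_smul, infCut,
    InfTerm.toTrees, infTermOne, graft]
  rw [Finsupp.sum_single_index (by simp)]
  have : ∀ g : (j : Fin 1) → ¬ j = 0 → Fin 1, (fun j : Fin 1 => if h : j = 0 then
      Finsupp.mapDomain (OpTree.paint (E := P.E.obj) true (id : Fin 1 → Fin 1))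
        (single (.leaf 0) (1 : k)) else single (.leaf (false, g j h)) 1)
      = fun _ => single (.leaf (true, 0)) 1 := by
    intro g
    funext j
    rw [dif_pos (Subsingleton.elim _ _)]
    simp [OpTree.paint, OpTree.map]
  rw [this, multiExt_single]
  simp [OpTree.word, OpTree.map, OpTree.bind, OpTree.deg, koszulExp]

theorem isDecomp_one :
    IsDecomp P.one [P.termOneLeft P.koszulDual P.lowWeight_le P.one] := by
  simp only [IsDecomp, List.map_cons, List.map_nil, List.sum_cons, List.sum_nil, add_zero]
  refine Eq.trans ?_ (P.termOneLeft_toTrees_leaf P.koszulDual P.lowWeight_le).symm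
  simp [QuadraticData.one, QuadraticData.repOne, cut]

theorem kappaOp_one (𝒜 : DGAlgebra P A) : 𝒜.kappaOp 1 0 P.one.elt = 0 := by
  change Finsupp.linearCombination k 𝒜.treeOp (single (.leaf 0) 1) = 0
  simp [DGAlgebra.treeOp]

variable (f : DerivedInfMorphism ℳ.toDerivedOps 𝒜.toDerivedOps)

theorem linear_apply (x : M) : f.linear x = f.map 1 0 P.one.elt fun _ => x := rfl

theorem linear_d {n : ℤ} {x : M} (hx : x ∈ ℳ.tot n) : 𝒜.d (f.linear x) = f.linear (ℳ.d x) := by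
  have h := f.map_eq P.one _ _ isInfDecomp_one isDecomp_one (fun _ => n) (fun _ => x) fun _ => hx
  have h1 : (infTermOne P).eval f.map ℳ.op (fun _ => n) (fun _ => x) = 0 := by
    have h0 : ℳ.op (infTermOne P).rB (infTermOne P).nB (infTermOne P).b.elt = 0 := ℳ.op_one
    rw [InfTerm.eval, h0]
    refine (congrArg _ (MultilinearMap.map_coord_zero _ (0 : Fin 1) ?_)).trans (smul_zero _)
    exact dif_pos rfl
  have h2 : (P.termOneLeft P.koszulDual P.lowWeight_le P.one).eval 𝒜.toDerivedOps.op f.map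
      (fun _ => n) (fun _ => x) = 0 := by
    have h0 : 𝒜.kappaOp 1 0 P.one.elt = 0 := kappaOp_one 𝒜
    rw [CompTerm.eval]
    refine (congrArg _ (DFunLike.congr_fun h0 _)).trans (smul_zero _)
  simp only [List.map_cons, List.map_nil, List.sum_cons, List.sum_nil, h1, h2, sumDiff,
    koszulSgn_zero, one_smul, add_zero, sub_zero, sub_eq_zero] at h
  simp only [Fin.sum_univ_one, sumBefore] at h
  rw [show (Finset.univ.filter fun j : Fin 1 => j < 0) = ∅ by decide, Finset.sum_empty,
    koszulSgn_zero, one_smul] at h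
  rw [linear_apply, linear_apply]
  refine h.trans (congrArg _ (funext fun i => ?_))
  rw [Subsingleton.elim i 0]
  simp

theorem linear₀_mem_ker (hf : f.IsMinimalModel) (x : M) : f.linear₀ x ∈ LinearMap.ker 𝒜.d := by
  induction x using ℳ.toBigrading.induction_on with
  | zero => simp
  | add x y hx hy => rw [map_add]; exact add_mem hx hy
  | hom b x hx =>
    obtain ⟨p, q⟩ := b
    rw [linear₀, Bigrading.linPiece_of_mem _ _ _ _ hx, Prod.mk_add_mk, add_zero, add_zero]
    by_cases hp : p = 0
    · subst hp
      have hx' : x ∈ ℳ.filt 0 q := by rwa [Bigrading.filt_zero]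
      have hfx : f.linear x ∈ 𝒜.toDerivedOps.gr (0, q) := by
        have := f.filtered 1 0 P.one.elt (fun _ => 0) (fun _ => q) (fun _ => x) fun _ => hx'
        rw [Fin.sum_univ_one, Fin.sum_univ_one, zero_add, zero_add, Bigrading.filt_zero] at this
        exact this
      rw [Bigrading.comp_of_mem _ hfx, LinearMap.mem_ker, f.linear_d (Bigrading.filt_le_tot _ _ _ hx')]
      have hdx := ℳ.d_mem _ _ _ hx'
      rw [Bigrading.filt_zero] at hdx
      have h0 := LinearMap.congr_fun hf.minimal x
      rw [DerivedOps.dPiece, Bigrading.linPiece_of_mem _ _ _ _ hx] at h0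
      have : ((0, q) : ℤ × ℤ) + (-0, -1 + 0) = (0, q - 1) :=
        Prod.ext (by simp) (by simp [sub_eq_add_neg])
      rw [this, Bigrading.comp_of_mem _ hdx] at h0
      rw [h0, LinearMap.zero_apply, map_zero]
    · have h := 𝒜.toDerivedOps.comp_mem (p, q) (f.linear x)
      have h' : 𝒜.toDerivedOps.gr (p, q) = ⊥ := by
        simp [DGAlgebra.toDerivedOps, horizontalGr, hp]
      rw [h', Submodule.mem_bot] at h
      rw [h]
      exact zero_mem _

/-- The map `ρ : ℳ → H_*(𝒜)` given by a minimal model: `f(1)₀` takes values in the cycles of `𝒜`, and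
`ρ` is its composite with the projection of the cycles onto the homology. -/
noncomputable def rho (hf : f.IsMinimalModel) : M →ₗ[k] 𝒜.Homology :=
  𝒜.homologyMk ∘ₗ f.linear₀.codRestrict (LinearMap.ker 𝒜.d) (f.linear₀_mem_ker hf)

end DerivedInfMorphism

/-!
Since `d₀ = 0`, the `E²` pages in filtrations `0` and `1` say that `M_{2,*} → M_{1,*} → M_{0,*}` with
the differential `d₁` is the beginning of a resolution of `H_*(A)`, with augmentation `f(1)₀`. As `A`
is concentrated in filtration `0`, this gives surjectivity of the augmentation
(`IsMinimalModel.exists_represents`), exactness at `M_{0,*}`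
(`IsMinimalModel.exists_dPiece_one_eq_of_mem_range`) and exactness at `M_{1,*}`
(`IsMinimalModel.exists_dPiece_one_eq_of_dPiece_one_eq_zero`), hence the `u i` and the `v i`.

The cogenerator `sμ` has the decompositions `Δ₍₁₎(sμ) = (1 ∘₁ sμ) + ∑ i, (sμ ∘_i 1)` and
`Δ(sμ) = (1; sμ) + (sμ; 1, ..., 1)`, and `1` acts as zero. So the operation `sμ` on `M` commutes with
`d` up to sign (`DerivedHomotopyAlgebra.d_op_gen`), and `f(sμ)` is a homotopy between `f(1) ∘ sμ` and
`μ ∘ f(1)^{⊗ r}` (`DerivedInfMorphism.linear_op_gen`).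

Consider `C = ∑ i, ± sμ(u, ..., v i, ..., u)`, with the signs of the torsion Massey product. The
elements `u i` are cycles and `d (v i) = t i • u i`, so `d C = (∑ i, t i) • sμ(u) = 0`. The component
of `C` in horizontal degree `1` is therefore a `d₁`-cycle, hence of the form `d₁ w`, and the component
in horizontal degree `0` is the sum of the `(sμ)₁`. Then `C - d w` has only a component in horizontal
degree `0`, namely the sum of the `(sμ)₁` minus `d₂ w`. Its image under `f(1)` is homologous to
`f(1)(C)`, which by the homotopy `f(sμ)`, and again since `∑ i, t i = 0`, is homologous to
`∑ i, ± μ(y, ..., z i, ..., y)` with `y i = f(1)(u i)` and `z i = f(1)(v i)`. This represents the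
torsion Massey product, because `d (z i) = t i • y i`.
-/

/-! ### Koszul signs of sorted words -/

theorem koszulExp_eq_zero_of_pairwise {κ : Type*} [LT κ] [DecidableRel (α := κ) (· < ·)]
    (l : List (κ × ℤ)) (h : l.Pairwise fun a b => ¬ b.1 < a.1) : koszulExp l = 0 := by
  induction l with
  | nil => rfl
  | cons a l ih =>
    obtain ⟨h₁, h₂⟩ := List.pairwise_cons.1 h
    rw [koszulExp, ih h₂, List.map_congr_left (g := fun _ => 0) fun b hb => if_neg (h₁ b hb)]
    simp

theorem koszulExp_ofFn_id {r : ℕ} (deg : Fin r → ℤ) :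
    koszulExp (List.ofFn fun i => (i, deg i)) = 0 := by
  refine koszulExp_eq_zero_of_pairwise _ (List.pairwise_ofFn.2 fun i j hij => ?_)
  exact not_lt.2 hij.le

theorem koszulSgn_add (k : Type*) [CommRing k] (a b : ℤ) :
    koszulSgn k (a + b) = koszulSgn k a * koszulSgn k b := by
  simp [koszulSgn, Int.negOnePow_add]

theorem koszulSgn_mul_self (k : Type*) [CommRing k] (a : ℤ) :
    koszulSgn k a * koszulSgn k a = 1 := by
  rw [← koszulSgn_add, koszulSgn, Int.negOnePow_even _ (Even.add_self a)]
  simp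

theorem koszulSgn_succ (k : Type*) [CommRing k] (a : ℤ) :
    koszulSgn k (a + 1) = -koszulSgn k a := by
  simp [koszulSgn, Int.negOnePow_succ]

/-! ### Decompositions of the cogenerators -/

namespace QuadraticData

variable {k : Type u} [CommRing k] (P : QuadraticData.{u, v} k)

/-- The term `(1 ∘₁ sμ)` of `Δ₍₁₎(sμ)`. -/
noncomputable def infTermLeft {r : ℕ} {n : ℤ} (e : P.E.obj r n) : InfTerm P.koszulDual r where
  rA := 1
  nA := 0
  a := P.one
  rB := r
  nB := n + 1
  b := P.gen e
  l := 0
  labA j := absurd (Subsingleton.elim j.1 0) j.2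
  labB := id
  lab_bij := ⟨by
      rintro (⟨a, ha⟩ | a) (⟨b, hb⟩ | b) h
      · exact absurd (Subsingleton.elim a 0) ha
      · exact absurd (Subsingleton.elim a 0) ha
      · exact absurd (Subsingleton.elim b 0) hb
      · simpa using h, fun b => ⟨Sum.inr b, rfl⟩⟩

/-- The term `(sμ ∘_i 1)` of `Δ₍₁₎(sμ)`. -/
noncomputable def infTermRight {r : ℕ} {n : ℤ} (e : P.E.obj r n) (i : Fin r) :
    InfTerm P.koszulDual r where
  rA := r
  nA := n + 1
  a := P.gen e
  rB := 1
  nB := 0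
  b := P.one
  l := i
  labA j := j.1
  labB _ := i
  lab_bij := ⟨by
      rintro (⟨a, ha⟩ | a) (⟨b, hb⟩ | b) h
      · exact congrArg Sum.inl (Subtype.ext h)
      · exact absurd h ha
      · exact absurd h.symm hb
      · exact congrArg Sum.inr (Subsingleton.elim a b), fun b => by
      by_cases h : b = i
      · exact ⟨Sum.inr 0, h.symm⟩
      · exact ⟨Sum.inl ⟨b, h⟩, rfl⟩⟩

theorem infTermLeft_toTrees {r : ℕ} {n : ℤ} (e : P.E.obj r n) :
    (P.infTermLeft e).toTrees
      = treeMk P.E 1 Bool (Bool × Fin r) (single ((OpTree.corolla e).paint true id) 1) := by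
  rw [← P.termOneLeft_toTrees_gen P.koszulDual P.lowWeight_le e]
  simp only [InfTerm.toTrees, CompTerm.toTrees, infTermLeft, termOneLeft, one, gen]
  congr 2

theorem infTermRight_toTrees {r : ℕ} {n : ℤ} (e : P.E.obj r n) (i : Fin r) :
    (P.infTermRight e i).toTrees
      = treeMk P.E 1 Bool (Bool × Fin r) (single (.node false r n e
          (Function.update (fun j => .leaf (false, j)) i (.leaf (true, i)))) 1) := by
  refine congrArg (treeMk P.E 1 Bool (Bool × Fin r)) (Eq.trans (b := graft P.E
    (single (OpTree.corolla e) 1) fun j : Fin r => single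
      (Function.update (fun j => OpTree.leaf (false, j)) i (OpTree.leaf (true, i)) j) 1) ?_ ?_)
  · simp only [infTermRight, one, repOne, gen, repGen, Finsupp.mapDomain_single, OpTree.paint,
      OpTree.map]
    congr 1
    funext j
    by_cases h : j = i
    · subst h
      simp
    · simp [h]
  · refine graft_corolla P.E e _ fun j => ?_
    by_cases h : j = i
    · subst h
      simp [OpTree.deg]
    · simp [h, OpTree.deg]

/-- `Δ₍₁₎(sμ) = (1 ∘₁ sμ) + ∑ i, (sμ ∘_i 1)`. -/
theorem isInfDecomp_gen {r : ℕ} {n : ℤ} (e : P.E.obj r n) :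
    IsInfDecomp (P.gen e) (P.infTermLeft e :: List.ofFn (P.infTermRight e)) := by
  rw [IsInfDecomp, List.map_cons, List.sum_cons, List.map_ofFn, List.sum_ofFn,
    infTermLeft_toTrees]
  simp only [Function.comp_apply, infTermRight_toTrees]
  rw [← map_sum, ← map_add]
  congr 1
  simp only [gen, repGen, Finsupp.linearCombination_single, one_smul, OpTree.corolla, infCut,
    Finsupp.mapDomain_single]
  rfl

/-- `Δ(sμ) = (1; sμ) + (sμ; 1, ..., 1)`. -/
theorem isDecomp_gen {r : ℕ} {n : ℤ} (e : P.E.obj r n) :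
    IsDecomp (P.gen e) [P.termOneLeft P.koszulDual P.lowWeight_le (P.gen e),
      P.termOneRight P.koszulDual P.lowWeight_le (P.gen e)] := by
  simp only [IsDecomp, List.map_cons, List.map_nil, List.sum_cons, List.sum_nil, add_zero]
  rw [gen, termOneLeft_toTrees_gen, termOneRight_toTrees_gen, repGen,
    Finsupp.linearCombination_single, one_smul, cut_corolla, map_add]

variable {P} {M N : Type*} [AddCommGroup M] [Module k M] [AddCommGroup N] [Module k N]

theorem infTermLeft_eval {r : ℕ} {n : ℤ} (e : P.E.obj r n) (φ : OpFamily P M N)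
    (ψ : OpFamily P M M) (deg : Fin r → ℤ) (x : Fin r → M) :
    (P.infTermLeft e).eval φ ψ deg x
      = φ 1 0 P.one.elt fun _ => ψ r (n + 1) (P.gen e).elt x := by
  -- In arity one every index is `0`, so the branches `g` below never occur.
  have h₁ : ∀ g : (j : Fin 1) → ¬ j = 0 → List (Fin r), ((List.ofFn fun j : Fin 1 =>
      if h : j = 0 then List.ofFn (id : Fin r → Fin r) else g j h).flatten.map
        fun i => (i, deg i)) = List.ofFn fun i => (i, deg i) := by
    intro g
    simp [List.ofFn_succ, List.map_ofFn]
  have h₂ : ∀ g : Fin 1 → ℤ, sumBefore g 0 = 0 := fun g => by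
    rw [sumBefore, show (Finset.univ.filter fun j : Fin 1 => j < 0) = ∅ by decide,
      Finset.sum_empty]
  have h₃ : ∀ g : (j : Fin 1) → ¬ j = 0 → M, (fun j : Fin 1 =>
      if h : j = 0 then ψ r (n + 1) (P.gen e).elt fun p => x (id p) else g j h)
        = fun _ => ψ r (n + 1) (P.gen e).elt x := fun g =>
    funext fun j => dif_pos (Subsingleton.elim _ _)
  have h₄ : ∀ a b c : ℤ, a = 0 → c = 0 → koszulSgn k (a + 0 + b * c) = 1 := by
    rintro a b c rfl rfl
    simp
  rw [InfTerm.eval]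
  refine Eq.trans (congrArg₂ (· • ·) (h₄ _ _ _ ?_ (h₂ _)) (congrArg _ (h₃ _))) (one_smul k _)
  exact (congrArg koszulExp (h₁ _)).trans (koszulExp_ofFn_id deg)

/-- The terms `(sμ ∘_i 1)` do not contribute to the structure equations, since `1` acts as zero. -/
theorem infTermRight_eval {r : ℕ} {n : ℤ} (e : P.E.obj r n) (i : Fin r) (φ : OpFamily P M N)
    (ψ : OpFamily P M M) (hψ : ψ 1 0 P.one.elt = 0) (deg : Fin r → ℤ) (x : Fin r → M) :
    (P.infTermRight e i).eval φ ψ deg x = 0 := by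
  rw [InfTerm.eval]
  refine (congrArg _ (MultilinearMap.map_coord_zero _ i ?_)).trans (smul_zero _)
  refine (dif_pos rfl).trans ?_
  exact DFunLike.congr_fun hψ _

/-- The term `(1; sμ)` does not contribute when `1` acts as zero. -/
theorem termOneLeft_eval {r : ℕ} {n : ℤ} (e : P.E.obj r n) (φ : OpFamily P N N)
    (hφ : φ 1 0 P.one.elt = 0) (f : OpFamily P M N) (deg : Fin r → ℤ) (x : Fin r → M) :
    (P.termOneLeft P.koszulDual P.lowWeight_le (P.gen e)).eval φ f deg x = 0 := by
  rw [CompTerm.eval]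
  exact (congrArg _ (DFunLike.congr_fun hφ _)).trans (smul_zero _)

theorem termOneRight_eval {r : ℕ} {n : ℤ} (e : P.E.obj r n) (φ : OpFamily P N N)
    (f : OpFamily P M N) (deg : Fin r → ℤ) (x : Fin r → M) :
    (P.termOneRight P.koszulDual P.lowWeight_le (P.gen e)).eval φ f deg x
      = φ r (n + 1) (P.gen e).elt fun j => f 1 0 P.one.elt fun _ => x j := by
  have h₁ : ((List.ofFn fun j : Fin r => List.ofFn fun _ : Fin 1 => j).flatten.map
      fun i => (i, deg i)) = List.ofFn fun i => (i, deg i) := by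
    simp only [List.ofFn_succ, List.ofFn_zero, flatten_ofFn_singleton, List.map_ofFn]
    rfl
  rw [CompTerm.eval]
  simp only [termOneRight]
  rw [h₁, koszulExp_ofFn_id]
  simp
  rfl

end QuadraticData

/-! ### The structure equations at a cogenerator -/

/-- The generator `sμ` acts on a differential graded algebra as `μ`. -/
theorem DGAlgebra.kappaOp_gen {k : Type u} [CommRing k] {P : QuadraticData.{u, v} k} {A : Type w}
    [AddCommGroup A] [Module k A] (𝒜 : DGAlgebra P A) {r : ℕ} {n : ℤ} (e : P.E.obj r n) :
    𝒜.kappaOp r (n + 1) (P.gen e).elt = 𝒜.op r n e := by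
  change Finsupp.linearCombination k 𝒜.treeOp (single (OpTree.corolla e) 1) = _
  -- A corolla determines the permutation of its leaves, which is the identity.
  have h : ∃ τ : Fin r ≃ Fin r, ∀ i,
      (OpTree.leaf i : OpTree P.E.obj Unit (Fin r)) = .leaf (τ i) :=
    ⟨Equiv.refl _, fun _ => rfl⟩
  have hτ : h.choose = Equiv.refl _ :=
    Equiv.ext fun i => (OpTree.leaf.inj (h.choose_spec i)).symm
  rw [Finsupp.linearCombination_single, one_smul, OpTree.corolla, treeOp, dif_pos h, hτ]
  exact congrArg (𝒜.op r n) (P.E.act_one e)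

/-- For `μ` in `E`, the operation `sμ` of a derived homotopy algebra commutes with the
differential. -/
theorem DerivedHomotopyAlgebra.d_op_gen {k : Type u} [CommRing k] {P : QuadraticData.{u, v} k}
    {M : Type w} [AddCommGroup M] [Module k M] (ℳ : DerivedHomotopyAlgebra P M) {r : ℕ} {n : ℤ}
    (μ : P.E.obj r n) (deg : Fin r → ℤ) (x : Fin r → M) (hx : ∀ i, x i ∈ ℳ.tot (deg i)) :
    ℳ.d (ℳ.op r (n + 1) (P.gen μ).elt x)
      = koszulSgn k n • sumDiff (ℳ.op r (n + 1) (P.gen μ).elt) ℳ.d deg x := by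
  have h := ℳ.op_eq (P.gen μ) _ (P.isInfDecomp_gen μ) deg x hx
  rw [List.map_cons, List.sum_cons, List.map_ofFn, List.sum_ofFn,
    QuadraticData.infTermLeft_eval, ℳ.op_one] at h
  simp only [Function.comp_apply, QuadraticData.infTermRight_eval _ _ _ _ ℳ.op_one] at h
  rw [add_sub_cancel_right] at h
  simpa [sub_eq_zero] using h

namespace DerivedInfMorphism

variable {k : Type u} [CommRing k] {P : QuadraticData.{u, v} k}
  {M A : Type*} [AddCommGroup M] [Module k M] [AddCommGroup A] [Module k A]
  {ℳ : DerivedHomotopyAlgebra P M} {𝒜 : DGAlgebra P A}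
  (f : DerivedInfMorphism ℳ.toDerivedOps 𝒜.toDerivedOps)

/-- For `μ` in `E`, the map `f(sμ)` is a homotopy between `f(1) ∘ sμ` and `μ ∘ f(1)^{⊗ r}`. -/
theorem linear_op_gen {r : ℕ} {n : ℤ} (μ : P.E.obj r n) (deg : Fin r → ℤ) (x : Fin r → M)
    (hx : ∀ i, x i ∈ ℳ.tot (deg i)) :
    f.linear (ℳ.op r (n + 1) (P.gen μ).elt x) =
      𝒜.op r n μ (fun i => f.linear (x i)) + 𝒜.d (f.map r (n + 1) (P.gen μ).elt x)
        + koszulSgn k n • sumDiff (f.map r (n + 1) (P.gen μ).elt) ℳ.d deg x := by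
  have h := f.map_eq (P.gen μ) _ _ (P.isInfDecomp_gen μ) (P.isDecomp_gen μ) deg x hx
  have h₁ : 𝒜.toDerivedOps.op 1 0 P.one.elt = 0 := kappaOp_one 𝒜
  have h₂ : 𝒜.toDerivedOps.op r (n + 1) (P.gen μ).elt = 𝒜.op r n μ := 𝒜.kappaOp_gen μ
  rw [List.map_cons, List.sum_cons, List.map_ofFn, List.sum_ofFn, List.map_cons, List.map_cons,
    List.map_nil, List.sum_cons, List.sum_cons, List.sum_nil, QuadraticData.infTermLeft_eval,
    QuadraticData.termOneLeft_eval _ _ h₁, QuadraticData.termOneRight_eval, h₂] at h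
  simp only [Function.comp_apply, QuadraticData.infTermRight_eval _ _ _ _ ℳ.op_one,
    Finset.sum_const_zero, add_zero, zero_add, koszulSgn_succ, neg_smul, sub_neg_eq_add] at h
  rw [eq_sub_iff_add_eq] at h
  rw [linear_apply, ← h]
  simp only [linear_apply]
  change 𝒜.d _ + _ + _ = _
  abel

end DerivedInfMorphism

/-! ### Bigraded and filtered modules -/

namespace Bigrading

variable {k : Type u} [CommRing k] {M : Type w} [AddCommGroup M] [Module k M] (G : Bigrading k M)

theorem comp_of_mem_ne {b c : ℤ × ℤ} {x : M} (hx : x ∈ G.gr b) (h : b ≠ c) : G.comp c x = 0 := by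
  let := G.dec
  simp only [comp, LinearMap.comp_apply, LinearEquiv.coe_coe, DirectSum.decomposeLinearEquiv_apply,
    Submodule.coe_subtype]
  exact DirectSum.decompose_of_mem_ne G.gr hx h

theorem gr_le_filt {p q m n : ℤ} (hp : p ≤ m) (hn : p + q = n) : G.gr (p, q) ≤ G.filt m n := by
  subst hn
  exact le_trans (by simp)
    (le_iSup₂_of_le (f := fun p' (_ : p' ∈ Set.Iic m) => G.gr (p', p + q - p')) p hp le_rfl)

theorem filt_mono {m m' : ℤ} (h : m ≤ m') (n : ℤ) : G.filt m n ≤ G.filt m' n :=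
  iSup₂_le fun _ hp => G.gr_le_filt (le_trans (Set.mem_Iic.1 hp) h) (by ring)

theorem filt_of_neg {m : ℤ} (hm : m < 0) (n : ℤ) : G.filt m n = ⊥ :=
  eq_bot_iff.2 <| iSup₂_le fun p hp => (G.nonneg p _ (lt_of_le_of_lt (Set.mem_Iic.1 hp) hm)).le

theorem comp_of_mem_filt_of_lt {m n p q : ℤ} {x : M} (hx : x ∈ G.filt m n) (h : m < p) :
    G.comp (p, q) x = 0 := by
  have : G.filt m n ≤ LinearMap.ker (G.comp (p, q)) := by
    refine iSup₂_le fun p' hp' y hy => ?_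
    exact G.comp_of_mem_ne hy fun e =>
      absurd (congrArg Prod.fst e) (lt_of_le_of_lt (Set.mem_Iic.1 hp') h).ne
  exact LinearMap.mem_ker.1 (this hx)

theorem sub_comp_mem_filt {m n : ℤ} {x : M} (hx : x ∈ G.filt m n) :
    x - G.comp (m, n - m) x ∈ G.filt (m - 1) n := by
  have : G.filt m n ≤ (G.filt (m - 1) n).comap (LinearMap.id - G.comp (m, n - m)) := by
    refine iSup₂_le fun p hp y hy => ?_
    change y - G.comp (m, n - m) y ∈ G.filt (m - 1) n
    rcases (show p ≤ m from hp).lt_or_eq with h | rfl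
    · rw [G.comp_of_mem_ne hy fun e => absurd (congrArg Prod.fst e) h.ne, sub_zero]
      exact G.gr_le_filt (by lia) (by ring) hy
    · rw [G.comp_of_mem hy, sub_self]
      exact zero_mem _
  exact this hx

theorem eq_comp_add_comp_of_mem_filt_one {n : ℤ} {x : M} (hx : x ∈ G.filt 1 n) :
    x = G.comp (1, n - 1) x + G.comp (0, n) x := by
  have h := G.sub_comp_mem_filt hx
  rw [sub_self, filt_zero] at h
  have h' := G.comp_of_mem h
  rw [map_sub, G.comp_of_mem_ne (G.comp_mem _ x) fun e => by simpa using congrArg Prod.fst e,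
    sub_zero] at h'
  rw [h']
  abel

end Bigrading

namespace DerivedHomotopyAlgebra

variable {k : Type u} [CommRing k] {P : QuadraticData.{u, v} k} {M : Type w} [AddCommGroup M]
  [Module k M] (ℳ : DerivedHomotopyAlgebra P M)

theorem dPiece_apply (i : ℤ) {p q p' q' : ℤ} {x : M} (hx : x ∈ ℳ.gr (p, q)) (hp : p - i = p')
    (hq : q - 1 + i = q') : ℳ.dPiece i x = ℳ.comp (p', q') (ℳ.d x) := by
  rw [DerivedOps.dPiece, Bigrading.linPiece_of_mem _ _ _ _ hx]
  congr 1
  subst hp hq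
  exact congrArg _ (Prod.ext (by simp [sub_eq_add_neg]) (by simp; ring))

/-- If `d₀ = 0`, then the differential strictly lowers the filtration. -/
theorem d_mem_filt_pred (h : ℳ.dPiece 0 = 0) {m n : ℤ} {x : M} (hx : x ∈ ℳ.filt m n) :
    ℳ.d x ∈ ℳ.filt (m - 1) (n - 1) := by
  have : ℳ.filt m n ≤ (ℳ.filt (m - 1) (n - 1)).comap ℳ.d := by
    refine iSup₂_le fun p hp y hy => ?_
    have h₁ := ℳ.sub_comp_mem_filt (ℳ.d_mem p n y (ℳ.gr_le_filt le_rfl (by ring) hy))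
    rw [← ℳ.dPiece_apply 0 hy (sub_zero p) (by ring), h, LinearMap.zero_apply, sub_zero] at h₁
    exact ℳ.filt_mono (sub_le_sub_right hp 1) _ h₁
  exact this hx

theorem d_eq_zero_of_mem (h : ℳ.dPiece 0 = 0) {q : ℤ} {x : M} (hx : x ∈ ℳ.gr (0, q)) :
    ℳ.d x = 0 := by
  rw [← Bigrading.filt_zero] at hx
  have := ℳ.d_mem_filt_pred h hx
  rwa [ℳ.filt_of_neg (by norm_num), Submodule.mem_bot] at this

theorem d_eq_dPiece_one (h : ℳ.dPiece 0 = 0) {q : ℤ} {x : M} (hx : x ∈ ℳ.gr (1, q)) :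
    ℳ.d x = ℳ.dPiece 1 x := by
  have := ℳ.d_mem_filt_pred h (ℳ.gr_le_filt le_rfl rfl hx)
  rw [sub_self, Bigrading.filt_zero] at this
  rw [ℳ.dPiece_apply 1 hx (sub_self 1) (q' := 1 + q - 1) (by ring), Bigrading.comp_of_mem _ this]

theorem d_eq_dPiece_one_add_dPiece_two (h : ℳ.dPiece 0 = 0) {q : ℤ} {x : M}
    (hx : x ∈ ℳ.gr (2, q)) : ℳ.d x = ℳ.dPiece 1 x + ℳ.dPiece 2 x := by
  have := ℳ.d_mem_filt_pred h (ℳ.gr_le_filt le_rfl rfl hx)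
  rw [show (2 : ℤ) - 1 = 1 by norm_num] at this
  rw [ℳ.dPiece_apply 1 hx (p' := 1) (q' := 2 + q - 1 - 1) (by norm_num) (by ring),
    ℳ.dPiece_apply 2 hx (sub_self 2) (q' := 2 + q - 1) (by ring)]
  exact ℳ.eq_comp_add_comp_of_mem_filt_one this

/-- The leading component of `d x` is `d₁` of the leading component of `x`. -/
theorem comp_d_of_mem_filt (h : ℳ.dPiece 0 = 0) {m n p q : ℤ} {x : M} (hx : x ∈ ℳ.filt m n)
    (hp : p + 1 = m) (hq : p + q + 1 = n) :
    ℳ.comp (p, q) (ℳ.d x) = ℳ.dPiece 1 (ℳ.comp (m, q) x) := by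
  have hn : n - m = q := by lia
  have h₁ := ℳ.d_mem_filt_pred h (ℳ.sub_comp_mem_filt hx)
  have h₂ := ℳ.comp_of_mem_filt_of_lt (q := q) h₁ (show m - 1 - 1 < p by lia)
  rw [hn, map_sub, map_sub, sub_eq_zero] at h₂
  rw [h₂, ℳ.dPiece_apply 1 (ℳ.comp_mem _ _) (p' := p) (q' := q) (by lia) (by ring)]

end DerivedHomotopyAlgebra

namespace DGAlgebra

variable {k : Type u} [CommRing k] {P : QuadraticData.{u, v} k} {A : Type w} [AddCommGroup A]
  [Module k A] (𝒜 : DGAlgebra P A)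

theorem filt_le_gr (m n : ℤ) : 𝒜.toDerivedOps.filt m n ≤ 𝒜.gr n := by
  refine iSup₂_le fun p _ => ?_
  by_cases hp : p = 0
  · subst hp
    exact (congrArg 𝒜.gr (sub_zero n)).le
  · simp [toDerivedOps, horizontalGr, hp]

theorem gr_le_filt {m : ℤ} (hm : 0 ≤ m) (n : ℤ) : 𝒜.gr n ≤ 𝒜.toDerivedOps.filt m n :=
  𝒜.toDerivedOps.toBigrading.gr_le_filt (p := 0) hm (zero_add n)

/-- A homogeneous boundary is the boundary of a homogeneous element. -/
theorem exists_mem_gr_d_eq {n : ℤ} {b : A} (hb : b ∈ 𝒜.gr n) (h : b ∈ LinearMap.range 𝒜.d) :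
    ∃ a ∈ 𝒜.gr (n + 1), 𝒜.d a = b := by
  let := 𝒜.dec
  have key : ∀ a, 𝒜.d (DirectSum.decompose 𝒜.gr a (n + 1)) =
      DirectSum.decompose 𝒜.gr (𝒜.d a) n := by
    intro a
    induction a using DirectSum.Decomposition.inductionOn 𝒜.gr with
    | zero => simp
    | @homogeneous m y =>
      by_cases hm : m = n + 1
      · subst hm
        have hy := 𝒜.d_mem _ _ y.2
        rw [add_sub_cancel_right] at hy
        rw [DirectSum.decompose_of_mem_same _ y.2, DirectSum.decompose_of_mem_same _ hy]
      · rw [DirectSum.decompose_of_mem_ne _ y.2 hm,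
          DirectSum.decompose_of_mem_ne _ (𝒜.d_mem _ _ y.2) (by lia), map_zero]
    | add x y hx hy => simp [hx, hy]
  obtain ⟨a, rfl⟩ := h
  exact ⟨_, Submodule.coe_mem _, (key a).trans (DirectSum.decompose_of_mem_same _ hb)⟩

theorem homologyMk_eq_zero_iff {a : A} (ha : a ∈ LinearMap.ker 𝒜.d) :
    𝒜.homologyMk ⟨a, ha⟩ = 0 ↔ a ∈ LinearMap.range 𝒜.d :=
  Submodule.Quotient.mk_eq_zero _

theorem homologyMk_eq_iff {a b : A} (ha : a ∈ LinearMap.ker 𝒜.d) (hb : b ∈ LinearMap.ker 𝒜.d) :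
    𝒜.homologyMk ⟨a, ha⟩ = 𝒜.homologyMk ⟨b, hb⟩ ↔ a - b ∈ LinearMap.range 𝒜.d :=
  Submodule.Quotient.eq _

end DGAlgebra

/-! ### The horizontal resolution of the homology -/

namespace DerivedInfMorphism

variable {k : Type u} [CommRing k] {P : QuadraticData.{u, v} k}
  {M A : Type*} [AddCommGroup M] [Module k M] [AddCommGroup A] [Module k A]
  {ℳ : DerivedHomotopyAlgebra P M} {𝒜 : DGAlgebra P A}
  (f : DerivedInfMorphism ℳ.toDerivedOps 𝒜.toDerivedOps)

theorem linear_mem_filt {m n : ℤ} {x : M} (hx : x ∈ ℳ.filt m n) :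
    f.linear x ∈ 𝒜.toDerivedOps.filt m n := by
  have := f.filtered 1 0 P.one.elt (fun _ => m) (fun _ => n) (fun _ => x) fun _ => hx
  rwa [Fin.sum_univ_one, Fin.sum_univ_one, zero_add, zero_add] at this

theorem linear_mem_gr {m n : ℤ} {x : M} (hx : x ∈ ℳ.filt m n) : f.linear x ∈ 𝒜.gr n :=
  𝒜.filt_le_gr _ _ (f.linear_mem_filt hx)

theorem linear₀_eq_linear {q : ℤ} {x : M} (hx : x ∈ ℳ.gr (0, q)) : f.linear₀ x = f.linear x := by
  have h : f.linear x ∈ 𝒜.toDerivedOps.gr (0, q) :=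
    f.linear_mem_gr (ℳ.gr_le_filt le_rfl (zero_add q) hx)
  rw [linear₀, Bigrading.linPiece_of_mem _ _ _ _ hx, Prod.mk_add_mk, add_zero, add_zero,
    Bigrading.comp_of_mem _ h]

variable {f}

/-- Surjectivity of the augmentation `M_{0,q} → H_q(A)`, from the `E²` pages in filtration `0`. -/
theorem IsMinimalModel.exists_represents (hf : f.IsMinimalModel)
    {q : ℤ} {x : 𝒜.Homology} (hx : x ∈ 𝒜.homologyDeg q) :
    ∃ u ∈ ℳ.gr (0, q), 𝒜.Represents (f.linear₀ u) x := by
  obtain ⟨⟨a, ha⟩, hq, rfl⟩ := hx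
  obtain ⟨u, hu, hau⟩ := (hf.equivalence 0 q).2 a
    ⟨𝒜.gr_le_filt le_rfl q hq, by
      rw [SetLike.mem_coe, Submodule.mem_comap, show 𝒜.toDerivedOps.d a = 0 from ha]
      exact zero_mem _⟩
  have hu₀ : u ∈ ℳ.gr (0, q) := by
    rw [← Bigrading.filt_zero]
    exact hu.1
  refine ⟨u, hu₀, f.linear₀_mem_ker hf u, ?_⟩
  rw [DGAlgebra.homologyMk_eq_iff, f.linear₀_eq_linear hu₀, ← neg_mem_iff, neg_sub]
  rw [Bigrading.boundaries₂, Bigrading.filt_of_neg _ (by norm_num), bot_inf_eq, bot_sup_eq] at hau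
  exact LinearMap.map_le_range hau

/-- Exactness of `M_{1,q} → M_{0,q} → H_q(A)`, from the `E²` pages in filtration `0`. -/
theorem IsMinimalModel.exists_dPiece_one_eq_of_mem_range (hf : f.IsMinimalModel)
    {q : ℤ} {u : M} (hu : u ∈ ℳ.gr (0, q))
    (h : f.linear u ∈ LinearMap.range 𝒜.d) : ∃ v ∈ ℳ.gr (1, q), ℳ.dPiece 1 v = u := by
  have hfu : f.linear u ∈ 𝒜.gr q := f.linear_mem_gr (ℳ.gr_le_filt le_rfl (zero_add q) hu)
  obtain ⟨a, ha, hda⟩ := 𝒜.exists_mem_gr_d_eq hfu h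
  have hb := (hf.equivalence 0 q).1 u
    ⟨ℳ.gr_le_filt le_rfl (zero_add q) hu, by
      rw [SetLike.mem_coe, Submodule.mem_comap, ℳ.d_eq_zero_of_mem hf.minimal hu]
      exact zero_mem _⟩
    (Submodule.mem_sup_right ⟨a, ⟨𝒜.gr_le_filt (by norm_num) _ ha, by
      rw [SetLike.mem_coe, Submodule.mem_comap, show 𝒜.toDerivedOps.d a = _ from hda]
      exact 𝒜.gr_le_filt le_rfl _ hfu⟩, hda⟩)
  rw [Bigrading.boundaries₂, Bigrading.filt_of_neg _ (by norm_num), bot_inf_eq, bot_sup_eq] at hb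
  obtain ⟨y, hy, rfl⟩ := hb
  refine ⟨_, ℳ.comp_mem (1, q) y, ?_⟩
  rw [← ℳ.comp_d_of_mem_filt hf.minimal (m := 1) (p := 0) hy.1 (by norm_num) (by ring)]
  exact Bigrading.comp_of_mem _ hu

/-- Exactness of `M_{2,q} → M_{1,q} → M_{0,q}`: the `E²` page of `A` vanishes in filtration `1`. -/
theorem IsMinimalModel.exists_dPiece_one_eq_of_dPiece_one_eq_zero (hf : f.IsMinimalModel)
    {q : ℤ} {c : M} (hc : c ∈ ℳ.gr (1, q)) (h : ℳ.dPiece 1 c = 0) :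
    ∃ w ∈ ℳ.gr (2, q), ℳ.dPiece 1 w = c := by
  have hd : ℳ.d c = 0 := (ℳ.d_eq_dPiece_one hf.minimal hc).trans h
  have hc' : c ∈ ℳ.filt 1 (1 + q) := ℳ.gr_le_filt le_rfl rfl hc
  have hb := (hf.equivalence 1 (1 + q)).1 c
    ⟨hc', by
      rw [SetLike.mem_coe, Submodule.mem_comap, hd]
      exact zero_mem _⟩
    (Submodule.mem_sup_left ⟨𝒜.gr_le_filt (by norm_num) _ (f.linear_mem_gr hc'), by
      rw [SetLike.mem_coe, Submodule.mem_comap, show 𝒜.toDerivedOps.d _ = _ from f.linear_d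
        (ℳ.filt_le_tot _ _ hc'), hd, map_zero]
      exact zero_mem _⟩)
  obtain ⟨a, ha, b, ⟨y, hy, rfl⟩, hab⟩ := Submodule.mem_sup.1 hb
  refine ⟨_, ℳ.comp_mem (2, q) y, ?_⟩
  rw [← ℳ.comp_d_of_mem_filt hf.minimal (m := 2) (p := 1) hy.1 (by norm_num) (by ring),
    ← ℳ.comp_of_mem hc, ← hab, map_add, ℳ.comp_of_mem_filt_of_lt ha.1 (by norm_num), zero_add]

end DerivedInfMorphism

/-! ### The cycle carrying the torsion Massey product -/

theorem sum_update_self_add {G : Type*} [AddCommGroup G] {r : ℕ} (g : Fin r → G) (i : Fin r) (a : G) :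
    ∑ j, Function.update g i (g i + a) j = ∑ j, g j + a := by
  rw [Finset.sum_update_of_mem (Finset.mem_univ i), add_right_comm, Finset.sdiff_singleton_eq_erase,
    Finset.add_sum_erase _ _ (Finset.mem_univ i)]

theorem sumBefore_update {r : ℕ} (deg : Fin r → ℤ) (i : Fin r) (a : ℤ) :
    sumBefore (Function.update deg i a) i = sumBefore deg i :=
  Finset.sum_congr rfl fun _ hj => Function.update_of_ne (Finset.mem_filter.1 hj).2.ne _ _

/-- If the `u j` are cycles and `d v = t • u i`, then the only differential which contributes to
`g(u, ..., v, ..., u)` is the one at the place `i`. -/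
theorem sumDiff_update {k : Type u} [CommRing k] {M N : Type*} [AddCommGroup M] [Module k M]
    [AddCommGroup N] [Module k N] {r : ℕ} (g : MultilinearMap k (fun _ : Fin r => M) N)
    (d : M →ₗ[k] M) (deg : Fin r → ℤ) (a : ℤ) (u : Fin r → M) (hu : ∀ j, d (u j) = 0) (i : Fin r)
    (v : M) (t : k) (hv : d v = t • u i) :
    sumDiff g d (Function.update deg i a) (Function.update u i v)
      = koszulSgn k (sumBefore deg i) • t • g u := by
  rw [sumDiff, Finset.sum_eq_single i]
  · rw [sumBefore_update, Function.update_self, Function.update_idem, hv, g.map_update_smul,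
      Function.update_eq_self]
  · intro j _ hj
    rw [Function.update_of_ne hj, hu, g.map_update_zero, smul_zero]
  · exact fun h => absurd (Finset.mem_univ i) h

/-- With the signs of the torsion Massey product and `∑ i, t i = 0`, the contributions of the
differentials of the `v i` cancel. -/
theorem sum_sgn_smul_sumDiff_update {k : Type u} [CommRing k] {M N : Type*} [AddCommGroup M]
    [Module k M] [AddCommGroup N] [Module k N] {r : ℕ} (n : ℤ)
    (g : MultilinearMap k (fun _ : Fin r => M) N) (d : M →ₗ[k] M) (deg : Fin r → ℤ)
    (a : Fin r → ℤ) (u v : Fin r → M) (hu : ∀ j, d (u j) = 0) (t : Fin r → k) (ht : ∑ i, t i = 0)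
    (hv : ∀ i, d (v i) = t i • u i) :
    ∑ i, koszulSgn k (n + sumBefore deg i) • koszulSgn k n •
      sumDiff g d (Function.update deg i (a i)) (Function.update u i (v i)) = 0 := by
  have h : ∀ i, koszulSgn k (n + sumBefore deg i) • koszulSgn k n •
      sumDiff g d (Function.update deg i (a i)) (Function.update u i (v i)) = t i • g u := by
    intro i
    rw [sumDiff_update g d deg (a i) u hu i (v i) (t i) (hv i), smul_smul, smul_smul,
      mul_assoc, ← koszulSgn_add, koszulSgn_mul_self, one_smul]
  rw [Finset.sum_congr rfl fun i _ => h i, ← Finset.sum_smul, ht, zero_smul]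

namespace DerivedHomotopyAlgebra

variable {k : Type u} [CommRing k] {P : QuadraticData.{u, v} k} {M : Type w} [AddCommGroup M]
  [Module k M] (ℳ : DerivedHomotopyAlgebra P M)

theorem update_mem_tot {r : ℕ} {deg : Fin r → ℤ} {u v : Fin r → M}
    (hu : ∀ i, u i ∈ ℳ.gr (0, deg i)) (hv : ∀ i, v i ∈ ℳ.gr (1, deg i)) (i j : Fin r) :
    Function.update u i (v i) j ∈ ℳ.tot (Function.update deg i (deg i + 1) j) := by
  by_cases h : j = i
  · subst h
    rw [Function.update_self, Function.update_self]
    exact ℳ.filt_le_tot 1 _ (ℳ.gr_le_filt le_rfl (add_comm _ _) (hv j))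
  · rw [Function.update_of_ne h, Function.update_of_ne h]
    exact ℳ.filt_le_tot 0 _ (ℳ.gr_le_filt le_rfl (zero_add _) (hu j))

theorem op_gen_update_mem_filt {r : ℕ} {n : ℤ} (μ : P.E.obj r n) {deg : Fin r → ℤ}
    {u v : Fin r → M} (hu : ∀ i, u i ∈ ℳ.gr (0, deg i)) (hv : ∀ i, v i ∈ ℳ.gr (1, deg i))
    (i : Fin r) :
    ℳ.op r (n + 1) (P.gen μ).elt (Function.update u i (v i))
      ∈ ℳ.filt 1 (n + ∑ j, deg j + 1) := by
  have h := ℳ.filtered r (n + 1) (P.gen μ).elt (Function.update (fun _ => 0) i (0 + 1))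
    (Function.update deg i (deg i + 1)) (Function.update u i (v i)) fun j => by
      by_cases h : j = i
      · subst h
        rw [Function.update_self, Function.update_self, Function.update_self]
        exact ℳ.gr_le_filt le_rfl (add_comm _ _) (hv j)
      · rw [Function.update_of_ne h, Function.update_of_ne h, Function.update_of_ne h]
        exact ℳ.gr_le_filt le_rfl (zero_add _) (hu j)
  rw [sum_update_self_add (fun _ => (0 : ℤ)), sum_update_self_add,
    Finset.sum_const_zero, zero_add] at h
  convert h using 2
  ring

/-- The piece `(sμ)ₛ(u, ..., v i, ..., u)` lies in a bidegree which does not depend on `i`. -/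
theorem opPiece_gen_update {r : ℕ} {n : ℤ} (μ : P.E.obj r n) (deg : Fin r → ℤ) (u v : Fin r → M)
    (i : Fin r) (s : ℤ) :
    ℳ.opPiece s (P.gen μ) (Function.update (fun j => (0, deg j)) i (1, deg i))
        (Function.update u i (v i))
      = ℳ.comp (1 - s, n + ∑ j, deg j + s)
        (ℳ.op r (n + 1) (P.gen μ).elt (Function.update u i (v i))) := by
  have h := sum_update_self_add (fun j => ((0, deg j) : ℤ × ℤ)) i (1, 0)
  rw [Prod.mk_add_mk, zero_add, add_zero] at h
  rw [DerivedOps.opPiece, h]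
  congr 2
  ext
  · simp [Prod.fst_sum, sub_eq_add_neg]
  · simp [Prod.snd_sum]
    ring

end DerivedHomotopyAlgebra

theorem mainTheorem3 {k : Type u} [CommRing k] (P : QuadraticData.{u, v} k)
    {M : Type*} [AddCommGroup M] [Module k M] {A : Type*} [AddCommGroup A] [Module k A]
    (𝒜 : DGAlgebra P A) (ℳ : DerivedHomotopyAlgebra P M)
    (f : DerivedInfMorphism ℳ.toDerivedOps 𝒜.toDerivedOps) (hf : f.IsMinimalModel)
    {r : ℕ} {n : ℤ} (μ : P.E.obj r n) (t : Fin r → k) (ht : ∑ i, t i = 0)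
    (deg : Fin r → ℤ) (x : Fin r → 𝒜.Homology) (hx : ∀ i, x i ∈ 𝒜.homologyDeg (deg i))
    (htx : ∀ i, t i • x i = 0) :
    (∃ u : Fin r → M, ∀ i, u i ∈ ℳ.gr (0, deg i) ∧ 𝒜.Represents (f.linear₀ (u i)) (x i)) ∧
    ∀ u : Fin r → M,
      (∀ i, u i ∈ ℳ.gr (0, deg i) ∧ 𝒜.Represents (f.linear₀ (u i)) (x i)) →
      (∃ v : Fin r → M, ∀ i, v i ∈ ℳ.gr (1, deg i) ∧ ℳ.dPiece 1 (v i) = t i • u i) ∧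
      ∀ v : Fin r → M,
        (∀ i, v i ∈ ℳ.gr (1, deg i) ∧ ℳ.dPiece 1 (v i) = t i • u i) →
        (∃ w ∈ ℳ.gr (2, n + ∑ i, deg i),
          ℳ.dPiece 1 w = ∑ i, koszulSgn k (n + sumBefore deg i) •
            ℳ.opPiece 0 (P.gen μ) (Function.update (fun j => (0, deg j)) i (1, deg i))
              (Function.update u i (v i))) ∧
        ∀ w ∈ ℳ.gr (2, n + ∑ i, deg i),
          ℳ.dPiece 1 w = ∑ i, koszulSgn k (n + sumBefore deg i) •
            ℳ.opPiece 0 (P.gen μ) (Function.update (fun j => (0, deg j)) i (1, deg i))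
              (Function.update u i (v i)) →
          ∑ i, koszulSgn k (n + sumBefore deg i) •
              f.rho hf (ℳ.opPiece 1 (P.gen μ) (Function.update (fun j => (0, deg j)) i (1, deg i))
                (Function.update u i (v i)))
            - f.rho hf (ℳ.dPiece 2 w) ∈
          (𝒜.homologyDeg (n + ∑ i, deg i + 1) : Set 𝒜.Homology) ∩ 𝒜.torsionMassey μ t deg x := by
  refine ⟨?_, fun u hu => ⟨?_, fun v hv => ?_⟩⟩
  · choose u hu using fun i => hf.exists_represents (hx i)
    exact ⟨u, hu⟩
  · have h : ∀ i, f.linear (t i • u i) ∈ LinearMap.range 𝒜.d := by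
      intro i
      obtain ⟨hu₀, hk, hux⟩ := hu i
      have h' := htx i
      rw [← hux, ← map_smul, SetLike.mk_smul_mk, DGAlgebra.homologyMk_eq_zero_iff,
        f.linear₀_eq_linear hu₀] at h'
      rwa [map_smul]
    choose v hv using fun i =>
      hf.exists_dPiece_one_eq_of_mem_range (Submodule.smul_mem _ (t i) (hu i).1) (h i)
    exact ⟨v, hv⟩
  -- `D + 1` is the total degree of the cycle `C` and of the element that represents the product.
  set D := n + ∑ i, deg i
  have hdu : ∀ i, ℳ.d (u i) = 0 := fun i => ℳ.d_eq_zero_of_mem hf.minimal (hu i).1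
  have hdv : ∀ i, ℳ.d (v i) = t i • u i := fun i =>
    (ℳ.d_eq_dPiece_one hf.minimal (hv i).1).trans (hv i).2
  have htot := ℳ.update_mem_tot (fun i => (hu i).1) fun i => (hv i).1
  set C := ∑ i, koszulSgn k (n + sumBefore deg i) •
    ℳ.op r (n + 1) (P.gen μ).elt (Function.update u i (v i)) with hC
  have hC₁ : C ∈ ℳ.filt 1 (D + 1) := sum_mem fun i _ => Submodule.smul_mem _ _
    (ℳ.op_gen_update_mem_filt μ (fun i => (hu i).1) (fun i => (hv i).1) i)
  -- `d C` is `(∑ i, t i) • sμ(u)`.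
  have hdC : ℳ.d C = 0 := by
    rw [hC, map_sum, ← sum_sgn_smul_sumDiff_update n (ℳ.op r (n + 1) (P.gen μ).elt) ℳ.d deg
      (fun i => deg i + 1) u v hdu t ht hdv]
    exact Finset.sum_congr rfl fun i _ => by rw [map_smul, ℳ.d_op_gen μ _ _ (htot i)]
  -- The sums of the pieces `(sμ)₀` and `(sμ)₁` are the components of `C` in horizontal degrees `1`
  -- and `0`.
  have hop : ∀ s, ∑ i, koszulSgn k (n + sumBefore deg i) •
      ℳ.opPiece s (P.gen μ) (Function.update (fun j => (0, deg j)) i (1, deg i))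
        (Function.update u i (v i)) = ℳ.comp (1 - s, D + s) C := by
    intro s
    rw [hC, map_sum]
    exact Finset.sum_congr rfl fun i _ => by rw [map_smul, ℳ.opPiece_gen_update]
  have hCc : C = ℳ.comp (1, D) C + ℳ.comp (0, D + 1) C := by
    have := ℳ.eq_comp_add_comp_of_mem_filt_one hC₁
    rwa [add_sub_cancel_right] at this
  rw [hop 0, sub_zero, add_zero]
  refine ⟨?_, fun w hw hdw => ?_⟩
  · -- The component of `d C = 0` in horizontal degree `0` only sees the top component of `C`.
    refine hf.exists_dPiece_one_eq_of_dPiece_one_eq_zero (ℳ.comp_mem _ C) ?_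
    have h := congrArg ℳ.d hCc
    rwa [hdC, map_add, ℳ.d_eq_zero_of_mem hf.minimal (ℳ.comp_mem _ C), add_zero,
      ℳ.d_eq_dPiece_one hf.minimal (ℳ.comp_mem _ C), eq_comm] at h
  -- Subtracting `d w` kills the top component of `C`, and leaves its class unchanged.
  have hs : ℳ.comp (0, D + 1) C - ℳ.dPiece 2 w = C - ℳ.d w := by
    rw [ℳ.d_eq_dPiece_one_add_dPiece_two hf.minimal hw, hdw]
    nth_rw 2 [hCc]
    abel
  have hs₀ : ℳ.comp (0, D + 1) C - ℳ.dPiece 2 w ∈ ℳ.gr (0, D + 1) := by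
    rw [ℳ.dPiece_apply 2 hw (sub_self 2) (q' := D + 1) (by ring)]
    exact sub_mem (ℳ.comp_mem _ _) (ℳ.comp_mem _ _)
  have hρ : ∑ i, koszulSgn k (n + sumBefore deg i) •
      f.rho hf (ℳ.opPiece 1 (P.gen μ) (Function.update (fun j => (0, deg j)) i (1, deg i))
        (Function.update u i (v i))) - f.rho hf (ℳ.dPiece 2 w)
      = 𝒜.homologyMk ⟨_, f.linear₀_mem_ker hf (ℳ.comp (0, D + 1) C - ℳ.dPiece 2 w)⟩ := by
    simp only [← map_smul]
    rw [← map_sum, hop 1, sub_self, ← map_sub]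
    rfl
  have hfs : f.linear₀ (ℳ.comp (0, D + 1) C - ℳ.dPiece 2 w)
      = f.linear C - 𝒜.d (f.linear w) := by
    rw [f.linear₀_eq_linear hs₀, hs, map_sub,
      f.linear_d (ℳ.filt_le_tot 2 _ (ℳ.gr_le_filt le_rfl rfl hw))]
  -- The homotopy `f(sμ)` moves `f(1)` past `sμ`; its terms with `d (v i)` sum to
  -- `(∑ i, t i) • f(sμ)(u) = 0`.
  have hfC : f.linear C = ∑ i, koszulSgn k (n + sumBefore deg i) •
        𝒜.op r n μ (Function.update (fun j => f.linear (u j)) i (f.linear (v i)))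
      + 𝒜.d (∑ i, koszulSgn k (n + sumBefore deg i) •
        f.map r (n + 1) (P.gen μ).elt (Function.update u i (v i))) := by
    have h0 := sum_sgn_smul_sumDiff_update n (f.map r (n + 1) (P.gen μ).elt) ℳ.d deg
      (fun i => deg i + 1) u v hdu t ht hdv
    have h : ∀ i ∈ Finset.univ, f.linear (koszulSgn k (n + sumBefore deg i) •
        ℳ.op r (n + 1) (P.gen μ).elt (Function.update u i (v i))) =
        koszulSgn k (n + sumBefore deg i) •
          𝒜.op r n μ (Function.update (fun j => f.linear (u j)) i (f.linear (v i)))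
        + 𝒜.d (koszulSgn k (n + sumBefore deg i) •
          f.map r (n + 1) (P.gen μ).elt (Function.update u i (v i)))
        + koszulSgn k (n + sumBefore deg i) • koszulSgn k n •
          sumDiff (f.map r (n + 1) (P.gen μ).elt) ℳ.d (Function.update deg i (deg i + 1))
            (Function.update u i (v i)) := by
      intro i _
      rw [map_smul, map_smul, f.linear_op_gen μ _ _ (htot i), smul_add, smul_add]
      congr 4
      funext j
      exact Function.apply_update (fun _ => f.linear) u i (v i) j
    rw [hC, map_sum, Finset.sum_congr rfl h, Finset.sum_add_distrib, h0, add_zero,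
      Finset.sum_add_distrib, map_sum]
  -- So the Massey representative for `y i = f(1)(u i)`, `z i = f(1)(v i)` is homologous to the image
  -- of `C - d w`.
  have hrep : ∑ i, koszulSgn k (n + sumBefore deg i) •
        𝒜.op r n μ (Function.update (fun j => f.linear (u j)) i (f.linear (v i)))
      = f.linear₀ (ℳ.comp (0, D + 1) C - ℳ.dPiece 2 w) + 𝒜.d (f.linear w -
        ∑ i, koszulSgn k (n + sumBefore deg i) •
          f.map r (n + 1) (P.gen μ).elt (Function.update u i (v i))) := by
    rw [hfs, hfC, map_sub]
    abel
  rw [hρ]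
  refine ⟨⟨_, ?_, rfl⟩, fun j => f.linear (u j), fun j => f.linear (v j),
    𝒜.homologyMk ⟨_, f.linear₀_mem_ker hf (ℳ.comp (0, D + 1) C - ℳ.dPiece 2 w)⟩, fun i => ⟨?_, ?_⟩,
    fun i => ⟨?_, ?_⟩, ⟨?_, ?_⟩, ?_⟩
  · change f.linear₀ (ℳ.comp (0, D + 1) C - ℳ.dPiece 2 w) ∈ 𝒜.gr (D + 1)
    rw [f.linear₀_eq_linear hs₀]
    exact f.linear_mem_gr (ℳ.gr_le_filt le_rfl (zero_add _) hs₀)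
  · exact f.linear_mem_gr (ℳ.gr_le_filt le_rfl (zero_add _) (hu i).1)
  · have h := (hu i).2
    rwa [f.linear₀_eq_linear (hu i).1] at h
  · exact f.linear_mem_gr (ℳ.gr_le_filt le_rfl (add_comm _ _) (hv i).1)
  · rw [f.linear_d (ℳ.filt_le_tot 1 _ (ℳ.gr_le_filt le_rfl rfl (hv i).1)), hdv, map_smul]
  · rw [hrep]
    exact add_mem (f.linear₀_mem_ker hf _) (𝒜.d_d _)
  · rw [DGAlgebra.homologyMk_eq_iff, hrep, add_sub_cancel_left]
    exact ⟨_, rfl⟩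
  · rw [sub_self]
    exact zero_mem _
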